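/- Let $B$ be a group, $\varphi\in\operatorname{Aut}(B)$, and $G=B\rtimes_\varphi\mathbb Z$ the infinite cyclic extension with underlying set $B\times\mathbb Z$ and multiplication $(x,r)(y,s)=(x\varphi^r(y),r+s)$; $B$ is regarded as a subgroup of $G$ via $b\mapsto(b,0)$. For a (discrete) group $\Gamma$, a family of subgroups of $\Gamma$ is a non-empty set of subgroups closed under conjugation and under taking subgroups, and a model for $E_{\mathfrak F}\Gamma$ is a $\Gamma$-CW-complex $X$ such that the fixed point space $X^H$ is contractible for every $H\in\mathfrak F$ and empty for every subgroup $H\notin\mathfrak F$ of $\Gamma$. Let $\mathfrak F$ be a family of subgroups of $B$ with $\varphi^k(H)\in\mathfrak F$ for all $H\in\mathfrak F$ and $k\in\mathbb Z$. Then $\mathfrak F$ is also a family of subgroups of $G$, and if there exists an $n$-dimensional model for $E_{\mathfrak F}B$, then there exists an $(n+1)$-dimensional model for $E_{\mathfrak F}G$. More precisely, let $X$ be an $n$-dimensional model for $E_{\mathfrak F}B$. Then there exists a continuous cellular map $f:X\to X$ with $f(bx)=\varphi^{-1}(b)f(x)$ for all $b\in B$, $x\in X$. For every such $f$, let $$Y_f=\Bigl(\coprod_{k\in\mathbb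 Z}X\times[0,1]\Bigr)\big/\sim$$ be the bi-infinite mapping telescope, where $\sim$ is the equivalence relation generated by identifying, for all $k\in\mathbb Z$ and $x\in X$, the point $(x,1)$ of the $k$-th cylinder with the point $(f(x),0)$ of the $(k+1)$-st cylinder, and let $(b,r)\in G$ act on $Y_f$ by mapping the class of the point $(x,t)$ of the $k$-th cylinder to the class of the point $(\varphi^{-(k+r)}(b)x,t)$ of the $(k+r)$-th cylinder. Then $Y_f$ with this $G$-action is an $(n+1)$-dimensional model for $E_{\mathfrak F}G$ (for a suitable CW structure). -/

import Mathlib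

open Set Topology
open scoped Pointwise unitInterval

namespace ClassifyingSpace

/-- A family of subgroups of `G`: a non-empty set of subgroups closed under conjugation and under
taking subgroups. -/
structure IsFamily {G : Type*} [Group G] (F : Set (Subgroup G)) : Prop where
  nonempty : F.Nonempty
  conj_mem : ∀ (g : G), ∀ H ∈ F, H.map (MulAut.conj g).toMonoidHom ∈ F
  mem_of_le : ∀ H ∈ F, ∀ K : Subgroup G, K ≤ H → K ∈ F

/-- Invariance of a set of subgroups under an automorphism `φ`: `φ ^ k (H)` belongs to it for
every member `H` and every integer `k`. -/
def IsInvariant {B : Type*} [Group B] (φ : MulAut B) (F : Set (Subgroup B)) : Prop :=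
  ∀ (k : ℤ), ∀ H ∈ F, H.map (φ ^ k : MulAut B).toMonoidHom ∈ F

/-- A `G`-CW-complex for a discrete group `G`: a (Hausdorff) CW-complex on which `G` acts by
homeomorphisms which permute the open cells of each dimension, such that an element of `G` which
maps some point of an open cell into the same open cell fixes this open cell pointwise. -/
structure IsGCWComplex (G X : Type*) [Group G] [TopologicalSpace X] [MulAction G X]
    [CWComplex (univ : Set X)] : Prop where
  t2Space : T2Space X
  continuous_smul : ∀ g : G, Continuous fun x : X => g • x
  smul_openCell : ∀ (g : G) (m : ℕ) (e : RelCWComplex.cell (univ : Set X) m),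
    ∃ e' : RelCWComplex.cell (univ : Set X) m,
      g • RelCWComplex.openCell (C := (univ : Set X)) m e = RelCWComplex.openCell m e'
  smul_eq_self : ∀ (g : G) (m : ℕ) (e : RelCWComplex.cell (univ : Set X) m),
    ∀ x ∈ RelCWComplex.openCell (C := (univ : Set X)) m e,
      g • x ∈ RelCWComplex.openCell (C := (univ : Set X)) m e →
      ∀ y ∈ RelCWComplex.openCell (C := (univ : Set X)) m e, g • y = y

/-- The CW-complex `X` has dimension exactly `n`: it has an `n`-cell and no cell of higher
dimension. -/
structure HasDimension (X : Type*) [TopologicalSpace X] [CWComplex (univ : Set X)] (n : ℕ) :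
    Prop where
  nonempty_cell : Nonempty (RelCWComplex.cell (univ : Set X) n)
  isEmpty_cell : ∀ m, n < m → IsEmpty (RelCWComplex.cell (univ : Set X) m)

/-- `X` is an `n`-dimensional model for `E_F G`: an `n`-dimensional `G`-CW-complex such that the
fixed point set `X^H` is contractible if `H ∈ F`, and empty if `H` is a subgroup of `G` that does
not belong to `F`. -/
structure IsModel (G : Type*) [Group G] (F : Set (Subgroup G)) (X : Type*) [TopologicalSpace X]
    [MulAction G X] [CWComplex (univ : Set X)] (n : ℕ) : Prop where
  isGCWComplex : IsGCWComplex G X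
  hasDimension : HasDimension X n
  contractible : ∀ H ∈ F, ContractibleSpace (MulAction.fixedPoints H X)
  fixedPoints_eq_empty : ∀ H : Subgroup G, H ∉ F → MulAction.fixedPoints H X = ∅

/-- The infinite cyclic extension `B ⋊ ℤ` in which `r : ℤ` acts on `B` by `φ ^ r`. -/
abbrev CyclicExtension {B : Type*} [Group B] (φ : MulAut B) : Type _ :=
  B ⋊[zpowersHom (MulAut B) φ] Multiplicative ℤ

/-- A set of subgroups of `B`, regarded as a set of subgroups of `B ⋊ ℤ` through the embedding
`b ↦ (b, 0)`. -/
def extendFamily {B : Type*} [Group B] (φ : MulAut B) (F : Set (Subgroup B)) :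
    Set (Subgroup (CyclicExtension φ)) :=
  (fun H => H.map (SemidirectProduct.inl : B →* CyclicExtension φ)) '' F

/-- A continuous map `f : X → X` with `f (b • x) = φ⁻¹ (b) • f x`, that is, a `B`-map from `X` to
the copy of `X` on which `b` acts as `φ⁻¹ (b)`. -/
structure TwistedMap {B : Type*} [Group B] (φ : MulAut B) (X : Type*) [TopologicalSpace X]
    [MulAction B X] where
  toFun : X → X
  continuous_toFun : Continuous toFun
  map_smul : ∀ (b : B) (x : X), toFun (b • x) = (φ⁻¹ : MulAut B) b • toFun x

/-- A map of CW-complexes is cellular if it maps the `m`-skeleton into the `m`-skeleton. -/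
def IsCellular {X Y : Type*} [TopologicalSpace X] [T2Space X] [TopologicalSpace Y] [T2Space Y]
    [CWComplex (univ : Set X)] [CWComplex (univ : Set Y)] (f : X → Y) : Prop :=
  ∀ m : ℕ, MapsTo f (RelCWComplex.skeleton (univ : Set X) m) (RelCWComplex.skeleton (univ : Set Y) m)

section Telescope

variable {B X : Type*} [Group B] [TopologicalSpace X] [MulAction B X] {φ : MulAut B}

/-- The gluing of the telescope: the point `(x, 1)` of the `k`-th cylinder is identified with the
point `(f x, 0)` of the `(k + 1)`-st cylinder. -/
inductive TelescopeRel (f : TwistedMap φ X) : ℤ × X × I → ℤ × X × I → Prop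
  | glue (k : ℤ) (x : X) : TelescopeRel f (k, x, 1) (k + 1, f.toFun x, 0)

/-- The bi-infinite mapping telescope of `f`: the quotient of the disjoint union of the cylinders
`X × [0, 1]`, one for each `k : ℤ`, by the equivalence relation generated by
`(k, x, 1) ∼ (k + 1, f x, 0)`. -/
def Telescope (f : TwistedMap φ X) : Type _ := Quot (TelescopeRel f)

instance (f : TwistedMap φ X) : TopologicalSpace (Telescope f) :=
  inferInstanceAs (TopologicalSpace (Quot (TelescopeRel f)))

/-- The action of `(b, r)` on the disjoint union of the cylinders: it maps the `k`-th cylinder to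
the `(k + r)`-th one, where `b` acts as `φ ^ (-(k + r)) (b)` acts on `X`. -/
def cylinderAct (g : CyclicExtension φ) (p : ℤ × X × I) : ℤ × X × I :=
  (p.1 + g.right.toAdd, (φ ^ (-(p.1 + g.right.toAdd)) : MulAut B) g.left • p.2.1, p.2.2)

theorem cylinderAct_rel (f : TwistedMap φ X) (g : CyclicExtension φ) (p q : ℤ × X × I)
    (h : TelescopeRel f p q) : TelescopeRel f (cylinderAct g p) (cylinderAct g q) := by
  obtain ⟨k, x⟩ := h
  have key : cylinderAct g (k + 1, f.toFun x, (0 : I)) =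
      (k + g.right.toAdd + 1,
        f.toFun ((φ ^ (-(k + g.right.toAdd)) : MulAut B) g.left • x), (0 : I)) := by
    simp only [cylinderAct, f.map_smul, ← MulAut.mul_apply, ← zpow_neg_one, ← zpow_add]
    rw [show k + 1 + g.right.toAdd = k + g.right.toAdd + 1 by ring,
      show -(k + g.right.toAdd + 1) = -1 + -(k + g.right.toAdd) by ring]
  rw [key]
  exact TelescopeRel.glue _ _

theorem cylinderAct_one {B X : Type*} [Group B] [MulAction B X] {φ : MulAut B} (p : ℤ × X × I) : cylinderAct (1 : CyclicExtension φ) p = p := by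
  simp [cylinderAct]

theorem cylinderAct_mul {B X : Type*} [Group B] [MulAction B X] {φ : MulAut B} (g h : CyclicExtension φ) (p : ℤ × X × I) :
    cylinderAct (g * h) p = cylinderAct g (cylinderAct h p) := by
  obtain ⟨k, x, t⟩ := p
  simp only [cylinderAct, SemidirectProduct.mul_left, SemidirectProduct.mul_right, toAdd_mul,
    zpowersHom_apply, map_mul, mul_smul, ← MulAut.mul_apply, ← zpow_add]
  rw [show k + (g.right.toAdd + h.right.toAdd) = k + h.right.toAdd + g.right.toAdd by ring,
    show -(k + h.right.toAdd + g.right.toAdd) + g.right.toAdd = -(k + h.right.toAdd) by ring]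

/-- The action of `B ⋊ ℤ` on the telescope: `(b, r)` maps the class of `(k, x, t)` to the class of
`(k + r, φ ^ (-(k + r)) (b) • x, t)`. -/
instance (f : TwistedMap φ X) : MulAction (CyclicExtension φ) (Telescope f) where
  smul g := Quot.map (cylinderAct g) (cylinderAct_rel f g)
  one_smul := by
    rintro ⟨p⟩
    exact congrArg (Quot.mk _) (cylinderAct_one p)
  mul_smul := by
    rintro g h ⟨p⟩
    exact congrArg (Quot.mk _) (cylinderAct_mul g h p)

end Telescope

end ClassifyingSpace

/-! Existence of `f`. Such an `f` is a `B`-map from `X` to the copy of `X` on which `B` acts through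
`φ⁻¹`, and it is built by induction over orbits of cells. A cell with pointwise stabilizer `H` has
to go into the fixed points of `φ⁻¹(H)`. Since `H` has a fixed point, `H ∈ F`; by invariance `φ⁻¹(H)
∈ F`, so that fixed point set is contractible and the map on the boundary sphere extends over the
ball (`exists_extension_closedBall`). The extension is made cellular by pushing it off the cells of
higher dimension (`exists_push_into_skeleton`). Fixed point sets are subcomplexes and the push never
leaves a subcomplex, so equivariance survives.

The telescope is a model. The height `k + t` is a continuous function to the line on which `(b, r)`
acts as translation by `r`, so a subgroup with a fixed point lies in `B`. On the `k`-th cylinder `b`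
acts as `φ^(-k)(b)`, so the fixed point set of `K ≤ B` is the telescope of the fixed point sets of
the groups `φ^(-k)(K)` in `X`. If `K ∈ F`, all of these are contractible, and then so is their
telescope, because its identity deforms to a map that factors through the line
(`contractibleSpace_familyTelescope`). If `K ∉ F`, all of them are empty.

The CW structure consists of the cells of the bottoms of the cylinders and the products of cells
with the open interval; tops need no cells, being glued to the next bottoms. Cellularity of `f`
keeps the boundary of a product cell in lower dimensions, and finiteness holds because a compact set
meets only finitely many open cells. -/

namespace ClassifyingSpace

/-! ### Pushing maps off cells of higher dimension -/

section PushOff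

open Metric

/-- A map on the image of a compact set is continuous if its composition with the parametrization
is continuous. -/
theorem continuousOn_image_of_isCompact {A Y Z : Type*} [TopologicalSpace A] [TopologicalSpace Y]
    [TopologicalSpace Z] [T2Space Y] {S : Set A} (hS : IsCompact S) {Φ : A → Y}
    (hΦ : ContinuousOn Φ S) {R : Y → Z} (hR : ContinuousOn (R ∘ Φ) S) :
    ContinuousOn R (Φ '' S) := by
  rw [continuousOn_iff_isClosed]
  intro t ht
  obtain ⟨u, hu, hut⟩ := continuousOn_iff_isClosed.1 hR t ht
  refine ⟨Φ '' (S ∩ u), ((hS.inter_right hu).image_of_continuousOn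
    (hΦ.mono inter_subset_left)).isClosed, ?_⟩
  ext y
  constructor
  · rintro ⟨hy, x, hx, rfl⟩
    have : x ∈ (R ∘ Φ) ⁻¹' t ∩ S := ⟨hy, hx⟩
    rw [hut] at this
    exact ⟨⟨x, ⟨hx, this.1⟩, rfl⟩, x, hx, rfl⟩
  · rintro ⟨⟨x, ⟨hx, hxu⟩, rfl⟩, h⟩
    have : x ∈ u ∩ S := ⟨hxu, hx⟩
    rw [← hut] at this
    exact ⟨this.1, h⟩

/-- A continuous map from a closed subset of `ℝ^m` to `ℝ^k` with `m < k` can be approximated by a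
map without zeros. -/
theorem exists_continuous_approx_ne_zero {m k : ℕ} (hmk : m < k) {K : Set (Fin m → ℝ)}
    (hK : IsClosed K) {u : (Fin m → ℝ) → (Fin k → ℝ)} (hu : ContinuousOn u K) {δ : ℝ}
    (hδ : 0 < δ) :
    ∃ p : (Fin m → ℝ) → (Fin k → ℝ), Continuous p ∧ (∀ y, p y ≠ 0) ∧
      ∀ y ∈ K, ‖p y - u y‖ < δ := by
  obtain ⟨U, hU⟩ := ContinuousMap.exists_restrict_eq hK ⟨K.domRestrict u, hu.domRestrict⟩
  obtain ⟨q, hq, hqU, -⟩ := U.continuous.exists_contDiff_approx (n := 1) (ε := fun _ => δ / 2)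
    continuous_const (fun _ => half_pos hδ)
  -- A `C¹` map into a space of larger dimension misses arbitrarily small vectors `z`; subtracting
  -- one of them removes all zeros.
  have hdense := ContDiff.dense_compl_range_of_finrank_lt_finrank hq (by simpa using hmk)
  obtain ⟨z, hz, hz0⟩ := hdense.exists_dist_lt (0 : Fin k → ℝ) (half_pos hδ)
  refine ⟨fun y => q y - z, hq.continuous.sub continuous_const, fun y hy => hz ⟨y, ?_⟩, ?_⟩
  · exact sub_eq_zero.1 hy
  · intro y hy
    have h1 : U y = u y := DFunLike.congr_fun hU ⟨y, hy⟩
    have h2 := hqU y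
    rw [dist_eq_norm, h1] at h2
    rw [dist_zero_left] at hz0
    calc ‖q y - z - u y‖ = ‖(q y - u y) - z‖ := by congr 1; abel
      _ ≤ ‖q y - u y‖ + ‖z‖ := norm_sub_le _ _
      _ < δ := by linarith

variable {X : Type*} [TopologicalSpace X] [T2Space X] {C : Set X} [CWComplex C]

theorem disjoint_cellFrontier_openCell (k : ℕ) (e : RelCWComplex.cell C k) :
    Disjoint (RelCWComplex.cellFrontier k e) (RelCWComplex.openCell k e) :=
  (RelCWComplex.disjoint_skeletonLT_openCell le_rfl).mono_left
    (RelCWComplex.cellFrontier_subset_skeletonLT k e)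

/-- A map from a compact subset of `ℝ^m` can be pushed off an open cell of dimension greater than
`m` which is relatively open in its image. -/
theorem exists_push_off_cell {m k : ℕ} (hmk : m < k) (e : RelCWComplex.cell C k)
    {D : Set (Fin m → ℝ)} (hD : IsCompact D) {g : (Fin m → ℝ) → X} (hg : ContinuousOn g D)
    (hcl : IsClosed {y ∈ D | g y ∉ RelCWComplex.openCell k e}) :
    ∃ g' : (Fin m → ℝ) → X, ContinuousOn g' D ∧ ∀ y ∈ D,
      (g y ∉ RelCWComplex.openCell k e → g' y = g y) ∧
      (g y ∈ RelCWComplex.openCell k e → g' y ∈ RelCWComplex.cellFrontier k e) := by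
  classical
  set Φ := RelCWComplex.map (C := C) k e with hΦ
  have hsrc : Φ.source = ball 0 1 := RelCWComplex.source_eq k e
  have hΦc : ContinuousOn Φ (closedBall 0 1) := RelCWComplex.continuousOn k e
  have htgt : Φ.target = RelCWComplex.openCell k e := by
    rw [← Φ.image_source_eq_target, hsrc]; rfl
  have hψc : ContinuousOn Φ.symm (RelCWComplex.openCell k e) :=
    htgt ▸ RelCWComplex.continuousOn_symm k e
  have hψΦ : ∀ z, ‖z‖ < 1 → Φ.symm (Φ z) = z := fun z hz =>
    Φ.left_inv (by rw [hsrc]; simpa using hz)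
  have hmem : ∀ z, ‖z‖ < 1 → Φ z ∈ RelCWComplex.openCell k e := fun z hz =>
    mem_image_of_mem _ (by simpa using hz)
  have hfr : ∀ z, ‖z‖ = 1 → Φ z ∈ RelCWComplex.cellFrontier k e := fun z hz =>
    mem_image_of_mem _ (by simpa using hz)
  have hψlt : ∀ x ∈ RelCWComplex.openCell k e, ‖Φ.symm x‖ < 1 := by
    rintro _ ⟨z, hz, rfl⟩
    have hz' : ‖z‖ < 1 := by simpa using hz
    change ‖Φ.symm (Φ z)‖ < 1
    rwa [hψΦ z hz']
  have hrad : ∀ z : Fin k → ℝ, z ≠ 0 → ‖(‖z‖⁻¹ • z)‖ = 1 := fun z hz => by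
    rw [norm_smul, norm_inv, norm_norm, inv_mul_cancel₀ (norm_ne_zero_iff.2 hz)]
  have hradc : ContinuousOn (fun z : Fin k → ℝ => Φ (‖z‖⁻¹ • z)) {z | z ≠ 0} := by
    refine hΦc.comp ?_ (fun z hz => ?_)
    · exact (continuous_norm.continuousOn.inv₀ (fun z hz => norm_ne_zero_iff.2 hz)).smul
        continuousOn_id
    · simpa using (hrad z hz).le
  -- the three pieces
  set K : Set (Fin m → ℝ) := D ∩ g ⁻¹' (Φ '' closedBall 0 (3 / 4)) with hKdef
  have hsub34 : closedBall (0 : Fin k → ℝ) (3 / 4) ⊆ closedBall 0 1 :=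
    closedBall_subset_closedBall (by norm_num)
  have hK : IsClosed K := hg.preimage_isClosed_of_isClosed hD.isClosed
    (((isCompact_closedBall _ _).image_of_continuousOn (hΦc.mono hsub34)).isClosed)
  have hKopen : ∀ y ∈ K, g y ∈ RelCWComplex.openCell k e := by
    rintro y ⟨-, z, hz, hzy⟩
    rw [← hzy]
    exact hmem z (by rw [mem_closedBall_zero_iff] at hz; linarith)
  have huc : ContinuousOn (fun y => Φ.symm (g y)) K :=
    hψc.comp (hg.mono inter_subset_left) hKopen
  obtain ⟨p, hp, hp0, hpu⟩ := exists_continuous_approx_ne_zero hmk hK huc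
    (show (0 : ℝ) < 1 / 8 by norm_num)
  -- The cutoff is 1 for `r ≤ 1/2` and 0 for `r ≥ 3/4`. So `v` equals `p` near the centre of the
  -- cell and the original coordinate in the outer shell. In between it differs by at most `1/8`
  -- from a vector of norm greater than `1/2`, hence it has no zero on `K`.
  let l : ℝ → ℝ := fun r => max 0 (min 1 (3 - 4 * r))
  have hl : Continuous l := by fun_prop
  let v : (Fin m → ℝ) → (Fin k → ℝ) := fun y =>
    Φ.symm (g y) + l ‖Φ.symm (g y)‖ • (p y - Φ.symm (g y))
  have hv34 : ∀ y, 3 / 4 ≤ ‖Φ.symm (g y)‖ → v y = Φ.symm (g y) := fun y hy => by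
    have : l ‖Φ.symm (g y)‖ = 0 := max_eq_left ((min_le_right _ _).trans (by linarith))
    simp [v, this]
  have hv0 : ∀ y ∈ K, v y ≠ 0 := by
    intro y hy h0
    by_cases h : ‖Φ.symm (g y)‖ ≤ 1 / 2
    · have : l ‖Φ.symm (g y)‖ = 1 := by
        simp only [l]
        rw [min_eq_left (by linarith), max_eq_right zero_le_one]
      apply hp0 y
      simpa [v, this] using h0
    · have h1 : ‖l ‖Φ.symm (g y)‖ • (p y - Φ.symm (g y))‖ ≤ 1 / 8 := by
        rw [norm_smul, Real.norm_eq_abs, abs_of_nonneg (le_max_left _ _)]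
        have : l ‖Φ.symm (g y)‖ ≤ 1 := max_le zero_le_one (min_le_left _ _)
        have h2 := (hpu y hy).le
        calc _ ≤ 1 * ‖p y - Φ.symm (g y)‖ := by gcongr
          _ ≤ 1 / 8 := by simpa using h2
      have h2 : Φ.symm (g y) = -(l ‖Φ.symm (g y)‖ • (p y - Φ.symm (g y))) :=
        eq_neg_of_add_eq_zero_left h0
      rw [h2, norm_neg] at h
      linarith
  have hvc : ContinuousOn v K :=
    huc.add ((hl.comp_continuousOn huc.norm).smul (hp.continuousOn.sub huc))
  let g' : (Fin m → ℝ) → X := fun y =>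
    if g y ∈ RelCWComplex.openCell k e then Φ (‖v y‖⁻¹ • v y) else g y
  -- Radial projection from the centre is the identity on the unit sphere, so both branches agree
  -- with `Φ (‖z‖⁻¹ • z)` on the closed shell `S`. Continuity descends to `Φ '' S` because `S` is
  -- compact.
  let R : X → X := fun x =>
    if x ∈ RelCWComplex.openCell k e then Φ (‖Φ.symm x‖⁻¹ • Φ.symm x) else x
  set S : Set (Fin k → ℝ) := closedBall 0 1 ∩ {z | 3 / 4 ≤ ‖z‖} with hSdef
  have hS : IsCompact S :=
    (isCompact_closedBall _ _).inter_right (isClosed_le continuous_const continuous_norm)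
  have hRΦ : ∀ z ∈ S, R (Φ z) = Φ (‖z‖⁻¹ • z) := by
    rintro z ⟨hz1, hz2⟩
    rw [mem_closedBall_zero_iff] at hz1
    rcases hz1.lt_or_eq with hz | hz
    · simp only [R, if_pos (hmem z hz), hψΦ z hz]
    · have := disjoint_left.1 (disjoint_cellFrontier_openCell k e) (hfr z hz)
      simp only [R, if_neg this, hz, inv_one, one_smul]
  have hRc : ContinuousOn R (Φ '' S) := by
    refine continuousOn_image_of_isCompact hS (hΦc.mono inter_subset_left) ?_
    refine (hradc.mono ?_).congr hRΦ
    rintro z ⟨-, hz⟩ rfl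
    simp only [mem_ofPred_eq, norm_zero] at hz
    linarith
  set A : Set (Fin m → ℝ) := D ∩ g ⁻¹' (Φ '' S) with hAdef
  have hA : IsClosed A := hg.preimage_isClosed_of_isClosed hD.isClosed
    ((hS.image_of_continuousOn (hΦc.mono inter_subset_left)).isClosed)
  refine ⟨g', ?_, fun y hy => ⟨fun h => if_neg h, fun h => ?_⟩⟩
  -- Three closed sets cover `D`: the points sent outside the cell, into the outer shell, and into
  -- the inner ball. An open cell need not be open in the complex, so closedness of the first set
  -- has to be assumed as `hcl`.
  · have h1 : ContinuousOn g' {y ∈ D | g y ∉ RelCWComplex.openCell k e} :=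
      (hg.mono fun y hy => hy.1).congr fun y hy => if_neg hy.2
    have h2 : ContinuousOn g' A := by
      refine (hRc.comp (hg.mono inter_subset_left) fun y hy => hy.2).congr ?_
      rintro y ⟨hyD, z, ⟨hz1, hz2⟩, hzy⟩
      by_cases hy : g y ∈ RelCWComplex.openCell k e
      · have hz : ‖z‖ < 1 := by
          rw [mem_closedBall_zero_iff] at hz1
          refine hz1.lt_of_ne fun hz => ?_
          exact disjoint_left.1 (disjoint_cellFrontier_openCell k e) (hfr z hz) (hzy ▸ hy)
        have : v y = Φ.symm (g y) := hv34 y (by rw [← hzy, hψΦ z hz]; exact hz2)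
        simp only [g', R, Function.comp_apply, if_pos hy, this]
      · simp only [g', R, Function.comp_apply, if_neg hy]
    have h3 : ContinuousOn g' K := by
      refine (hradc.comp hvc hv0).congr fun y hy => if_pos (hKopen y hy)
    have h12 := h1.union_of_isClosed h2 hcl hA
    have h123 := h12.union_of_isClosed h3 (hcl.union hA) hK
    refine h123.mono fun y hy => ?_
    by_cases hyo : g y ∈ RelCWComplex.openCell k e
    · obtain ⟨z, hz, hzy⟩ := id hyo
      rw [mem_ball_zero_iff] at hz
      by_cases h34 : ‖z‖ ≤ 3 / 4
      · exact Or.inr ⟨hy, z, by simpa using h34, hzy⟩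
      · exact Or.inl (Or.inr ⟨hy, z, ⟨by simpa using hz.le, (not_le.1 h34).le⟩, hzy⟩)
    · exact Or.inl (Or.inl ⟨hy, hyo⟩)
  · have hv : v y ≠ 0 := by
      by_cases h34 : 3 / 4 ≤ ‖Φ.symm (g y)‖
      · rw [hv34 y h34]
        intro h0
        rw [h0, norm_zero] at h34
        linarith
      · refine hv0 y ⟨hy, Φ.symm (g y), by simpa using (not_le.1 h34).le, ?_⟩
        exact Φ.right_inv (htgt ▸ h)
    simp only [g', if_pos h]
    exact hfr _ (hrad _ hv)

/-- A compact set meets only finitely many open cells. -/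
theorem finite_openCell_inter_of_isCompact {K : Set X} (hK : IsCompact K) (hKC : K ⊆ C) :
    {e : Σ n, RelCWComplex.cell C n |
      (RelCWComplex.openCell (C := C) e.1 e.2 ∩ K).Nonempty}.Finite := by
  set J := {e : Σ n, RelCWComplex.cell C n |
      (RelCWComplex.openCell (C := C) e.1 e.2 ∩ K).Nonempty} with hJ
  rcases isEmpty_or_nonempty X with _ | _
  · exact finite_empty.subset fun e he => isEmptyElim he.some
  choose! p hp using fun (e : Σ n, RelCWComplex.cell C n) (he : e ∈ J) => he
  have hinj : InjOn p J := by
    intro e he e' he' h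
    refine RelCWComplex.eq_of_not_disjoint_openCell (not_disjoint_iff.2 ⟨p e, (hp e he).1, ?_⟩)
    rw [h]
    exact (hp e' he').1
  -- One point is chosen in each open cell that is met. Each closed cell contains finitely many
  -- chosen points, so every set of chosen points is closed; the chosen points form a compact
  -- discrete set, which is finite.
  have hfinclosed : ∀ (n : ℕ) (e : RelCWComplex.cell C n),
      (p '' J ∩ RelCWComplex.closedCell n e).Finite := by
    intro n e
    obtain ⟨s, hs⟩ := CWComplex.cellFrontier_subset_finite_openCell n e
    have hfin : ((⋃ m ∈ Finset.range n, ⋃ i ∈ s m,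
        {(⟨m, i⟩ : Σ n, RelCWComplex.cell C n)}) ∪ {⟨n, e⟩}).Finite :=
      (Set.Finite.biUnion (Finset.finite_toSet _) fun m _ =>
        Set.Finite.biUnion (Finset.finite_toSet _) fun i _ => finite_singleton _).union
        (finite_singleton _)
    refine (hfin.image p).subset ?_
    rintro _ ⟨⟨a, ha, rfl⟩, hae⟩
    refine ⟨a, ?_, rfl⟩
    rw [← RelCWComplex.cellFrontier_union_openCell_eq_closedCell] at hae
    rcases hae with hae | hae
    · have := hs hae
      simp only [mem_iUnion, exists_prop] at this
      obtain ⟨m, hm, i, hi, hai⟩ := this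
      have : a = ⟨m, i⟩ := RelCWComplex.eq_of_not_disjoint_openCell
        (not_disjoint_iff.2 ⟨p a, (hp a ha).1, hai⟩)
      left
      simp only [mem_iUnion, Finset.mem_range, exists_prop]
      exact ⟨m, hm, i, hi, this⟩
    · exact Or.inr (RelCWComplex.eq_of_not_disjoint_openCell
        (not_disjoint_iff.2 ⟨p a, (hp a ha).1, hae⟩))
  have hclosed : ∀ T ⊆ p '' J, IsClosed T := by
    intro T hT
    have hTC : T ⊆ C := by
      intro x hx
      obtain ⟨a, ha, rfl⟩ := hT hx
      exact hKC (hp a ha).2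
    rw [CWComplex.closed C T hTC]
    intro n e
    exact ((hfinclosed n e).subset (inter_subset_inter_left _ hT)).isClosed
  have hdisc : IsDiscrete (p '' J) := by
    rw [isDiscrete_iff_forall_mem_exists_isOpen]
    intro x hx
    refine ⟨(p '' J \ {x})ᶜ, (hclosed _ sdiff_subset).isOpen_compl, ?_⟩
    ext y
    simp only [mem_inter_iff, mem_compl_iff, mem_sdiff, mem_singleton_iff]
    constructor
    · rintro ⟨h1, h2⟩
      by_contra h
      exact h1 ⟨h2, h⟩
    · rintro rfl
      exact ⟨fun h => h.2 rfl, hx⟩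
  have hcpt : IsCompact (p '' J) := hK.of_isClosed_subset (hclosed _ le_rfl)
    (by rintro _ ⟨a, ha, rfl⟩; exact (hp a ha).2)
  exact Set.Finite.of_finite_image (hcpt.finite hdisc) hinj

/-- A map from the `m`-ball to a skeleton can be pushed into the `m`-skeleton, without changing it
where its values are in the `m`-skeleton and without leaving subcomplexes. -/
theorem exists_push_into_skeleton {m : ℕ} (N : ℕ) : ∀ g : (Fin m → ℝ) → X,
    ContinuousOn g (closedBall 0 1) →
    (∀ y ∈ closedBall (0 : Fin m → ℝ) 1, g y ∈ RelCWComplex.skeletonLT C N) →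
    ∃ g' : (Fin m → ℝ) → X, ContinuousOn g' (closedBall 0 1) ∧
      ∀ y ∈ closedBall (0 : Fin m → ℝ) 1,
        g' y ∈ RelCWComplex.skeletonLT C (m + 1) ∧
        (g y ∈ RelCWComplex.skeletonLT C (m + 1) → g' y = g y) ∧
        ∀ E : RelCWComplex.Subcomplex C, g y ∈ E → g' y ∈ E := by
  induction N with
  | zero =>
    intro g hg hN
    refine ⟨g, hg, fun y hy => ⟨?_, fun _ => rfl, fun _ h => h⟩⟩
    exact RelCWComplex.skeletonLT_mono (by simp) (hN y hy)
  | succ N ih =>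
    intro g hg hN
    by_cases hNm : N ≤ m
    · refine ⟨g, hg, fun y hy => ⟨?_, fun _ => rfl, fun _ h => h⟩⟩
      exact RelCWComplex.skeletonLT_mono (by exact_mod_cast Nat.succ_le_succ hNm) (hN y hy)
    push Not at hNm
    -- The `N`-cells are cleared one at a time. `J` lists those that the image may still meet; it
    -- starts finite because the image is compact.
    have key : ∀ J : Finset (RelCWComplex.cell C N), ∀ g : (Fin m → ℝ) → X,
        ContinuousOn g (closedBall 0 1) →
        (∀ y ∈ closedBall (0 : Fin m → ℝ) 1, g y ∈ RelCWComplex.skeletonLT C (N + 1 : ℕ)) →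
        (∀ e ∉ J, ∀ y ∈ closedBall (0 : Fin m → ℝ) 1, g y ∉ RelCWComplex.openCell N e) →
        ∃ g' : (Fin m → ℝ) → X, ContinuousOn g' (closedBall 0 1) ∧
          ∀ y ∈ closedBall (0 : Fin m → ℝ) 1, g' y ∈ RelCWComplex.skeletonLT C N ∧
            (g y ∈ RelCWComplex.skeletonLT C N → g' y = g y) ∧
            ∀ E : RelCWComplex.Subcomplex C, g y ∈ E → g' y ∈ E := by
      classical
      intro J
      induction J using Finset.induction_on with
      | empty =>
        intro g hg hN hJ
        refine ⟨g, hg, fun y hy => ⟨?_, fun _ => rfl, fun _ h => h⟩⟩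
        obtain ⟨l, hl, e, he⟩ := CWComplex.mem_skeletonLT_iff.1 (hN y hy)
        have hl' : l < N + 1 := by exact_mod_cast hl
        rcases (Nat.lt_succ_iff.1 hl').lt_or_eq with h | rfl
        · exact CWComplex.mem_skeletonLT_iff.2 ⟨l, by exact_mod_cast h, e, he⟩
        · exact absurd he (hJ e (by simp) y hy)
      | insert e J heJ ihJ =>
        intro g hg hN hJ
        -- Missing `e` means lying in the lower skeleton or in one of finitely many other closed
        -- cells, which is a closed condition, as pushing off `e` requires.
        have hsub : ∀ y ∈ closedBall (0 : Fin m → ℝ) 1, g y ∉ RelCWComplex.openCell N e ↔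
            g y ∈ (RelCWComplex.skeletonLT C N : Set X) ∪
              ⋃ e' ∈ J, RelCWComplex.closedCell N e' := by
          intro y hy
          constructor
          · intro h
            obtain ⟨l, hl, e', he'⟩ := CWComplex.mem_skeletonLT_iff.1 (hN y hy)
            have hl' : l < N + 1 := by exact_mod_cast hl
            rcases (Nat.lt_succ_iff.1 hl').lt_or_eq with h' | rfl
            · exact Or.inl (CWComplex.mem_skeletonLT_iff.2 ⟨l, by exact_mod_cast h', e', he'⟩)
            · right
              have hne : e' ≠ e := by rintro rfl; exact h he'
              have : e' ∈ J := by
                by_contra hc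
                exact hJ e' (by simp [hne, hc]) y hy he'
              exact mem_biUnion this (RelCWComplex.openCell_subset_closedCell _ _ he')
          · rintro (h | h) h'
            · exact disjoint_left.1 (RelCWComplex.disjoint_skeletonLT_openCell le_rfl) h h'
            · simp only [mem_iUnion, exists_prop] at h
              obtain ⟨e', he'J, he'⟩ := h
              rw [← RelCWComplex.cellFrontier_union_openCell_eq_closedCell] at he'
              rcases he' with he' | he'
              · exact disjoint_left.1 (RelCWComplex.disjoint_skeletonLT_openCell le_rfl)
                  (RelCWComplex.cellFrontier_subset_skeletonLT N e' he') h'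
              · have := RelCWComplex.eq_of_not_disjoint_openCell
                  (not_disjoint_iff.2 ⟨g y, he', h'⟩)
                simp only [Sigma.mk.injEq, heq_eq_eq, true_and] at this
                exact heJ (this ▸ he'J)
        have hcl : IsClosed {y ∈ closedBall (0 : Fin m → ℝ) 1 |
            g y ∉ RelCWComplex.openCell N e} := by
          have : {y ∈ closedBall (0 : Fin m → ℝ) 1 | g y ∉ RelCWComplex.openCell N e} =
              closedBall 0 1 ∩ g ⁻¹' ((RelCWComplex.skeletonLT C N : Set X) ∪
                ⋃ e' ∈ J, RelCWComplex.closedCell N e') := by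
            ext y
            exact and_congr_right fun hy => hsub y hy
          rw [this]
          refine hg.preimage_isClosed_of_isClosed isClosed_closedBall ?_
          exact (RelCWComplex.skeletonLT C N).closed'.union
            (J.finite_toSet.isClosed_biUnion fun _ _ => RelCWComplex.isClosed_closedCell)
        obtain ⟨g₁, hg₁, hg₁'⟩ := exists_push_off_cell hNm e (isCompact_closedBall _ _) hg hcl
        have hfrN := RelCWComplex.cellFrontier_subset_skeletonLT N e
        -- A subcomplex that meets an open cell contains its frontier, where the pushed point lands.
        have hsubE : ∀ y ∈ closedBall (0 : Fin m → ℝ) 1, ∀ E : RelCWComplex.Subcomplex C,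
            g y ∈ E → g₁ y ∈ E := by
          intro y hy E hE
          by_cases h : g y ∈ RelCWComplex.openCell N e
          · have heE : e ∈ E.I N := by
              by_contra hc
              exact disjoint_left.1
                (RelCWComplex.Subcomplex.disjoint_openCell_subcomplex_of_not_mem E hc) h hE
            exact RelCWComplex.Subcomplex.cellFrontier_subset_of_mem E heE ((hg₁' y hy).2 h)
          · rw [(hg₁' y hy).1 h]
            exact hE
        obtain ⟨g₂, hg₂, hg₂'⟩ := ihJ g₁ hg₁ (fun y hy => hsubE y hy _ (hN y hy)) (by
          intro e' he' y hy h'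
          by_cases h : g y ∈ RelCWComplex.openCell N e
          · exact disjoint_left.1 (RelCWComplex.disjoint_skeletonLT_openCell le_rfl)
              (hfrN ((hg₁' y hy).2 h)) h'
          · rw [(hg₁' y hy).1 h] at h'
            by_cases hee : e' = e
            · exact h (hee ▸ h')
            · exact hJ e' (by simp [hee, he']) y hy h')
        refine ⟨g₂, hg₂, fun y hy => ⟨(hg₂' y hy).1, fun h => ?_, fun E hE =>
          (hg₂' y hy).2.2 E (hsubE y hy E hE)⟩⟩
        have hgy : g₁ y = g y := (hg₁' y hy).1 fun h' =>
          disjoint_left.1 (RelCWComplex.disjoint_skeletonLT_openCell le_rfl) h h'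
        rw [(hg₂' y hy).2.1 (hgy ▸ h), hgy]
    have hcpt : IsCompact (g '' closedBall 0 1) :=
      (isCompact_closedBall _ _).image_of_continuousOn hg
    have hfin := finite_openCell_inter_of_isCompact (C := C) hcpt (by
      rintro _ ⟨y, hy, rfl⟩
      exact (RelCWComplex.skeletonLT C _).subset_complex (hN y hy))
    have hfin' : {e : RelCWComplex.cell C N |
        (RelCWComplex.openCell N e ∩ g '' closedBall 0 1).Nonempty}.Finite :=
      hfin.preimage (f := fun e => (⟨N, e⟩ : Σ n, RelCWComplex.cell C n))
        sigma_mk_injective.injOn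
    obtain ⟨g₁, hg₁, hg₁'⟩ := key hfin'.toFinset g hg hN (by
      intro e he y hy h
      exact he (by simpa using ⟨g y, h, y, by simpa using hy, rfl⟩))
    obtain ⟨g₂, hg₂, hg₂'⟩ := ih g₁ hg₁ fun y hy => (hg₁' y hy).1
    refine ⟨g₂, hg₂, fun y hy => ⟨(hg₂' y hy).1, fun h => ?_, fun E hE =>
      (hg₂' y hy).2.2 E ((hg₁' y hy).2.2 E hE)⟩⟩
    have hgy : g₁ y = g y := (hg₁' y hy).2.1
      (RelCWComplex.skeletonLT_mono (by exact_mod_cast hNm) h)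
    rw [(hg₂' y hy).2.1 (hgy ▸ h), hgy]

end PushOff

/-! ### Extending twisted equivariant maps over cells -/

section EquivariantExtension

open Metric RelCWComplex

/-- A map from a sphere to a contractible subspace extends to the ball. -/
theorem exists_extension_closedBall {X : Type*} [TopologicalSpace X] {Z : Set X}
    [ContractibleSpace Z] {m : ℕ} {g : (Fin m → ℝ) → X} (hg : ContinuousOn g (sphere 0 1))
    (hgZ : MapsTo g (sphere 0 1) Z) :
    ∃ g' : (Fin m → ℝ) → X, ContinuousOn g' (closedBall 0 1) ∧ MapsTo g' (closedBall 0 1) Z ∧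
      EqOn g' g (sphere 0 1) := by
  classical
  obtain ⟨z₀, ⟨c⟩⟩ := id_nullhomotopic Z
  have hc0 : ∀ z, c (0, z) = z := fun z => c.apply_zero z
  have hc1 : ∀ z, c (1, z) = z₀ := fun z => c.apply_one z
  -- For `m = 0` the sphere is empty, so polar coordinates would miss the single point of the ball.
  rcases Nat.eq_zero_or_pos m with rfl | hm
  · refine ⟨fun _ => z₀, continuousOn_const, fun _ _ => z₀.2, fun y hy => ?_⟩
    have h := mem_sphere_zero_iff_norm.1 hy
    rw [Subsingleton.elim y 0, norm_zero] at h
    exact absurd h zero_ne_one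
  let γ : (Fin m → ℝ) → Z := fun y => if h : y ∈ sphere (0 : Fin m → ℝ) 1 then ⟨g y, hgZ h⟩ else z₀
  have hγ : ∀ y ∈ sphere (0 : Fin m → ℝ) 1, (γ y : X) = g y := fun y hy => by
    simp only [γ, dif_pos hy]
  have hγc : ContinuousOn γ (sphere 0 1) := by
    rw [IsInducing.subtypeVal.continuousOn_iff]
    exact hg.congr hγ
  -- The contraction is run along the radii, reaching `z₀` at the centre. Continuity is checked in
  -- polar coordinates `Φ` on the compact set `S`.
  let R : (Fin m → ℝ) → Z := fun y =>
    if y = 0 then z₀ else c (projIcc 0 1 zero_le_one (1 - ‖y‖), γ (‖y‖⁻¹ • y))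
  let Φ : (Fin m → ℝ) × ℝ → (Fin m → ℝ) := fun p => p.2 • p.1
  set S : Set ((Fin m → ℝ) × ℝ) := sphere 0 1 ×ˢ Icc 0 1 with hS
  have hSc : IsCompact S := (isCompact_sphere _ _).prod isCompact_Icc
  have hRΦ : EqOn (R ∘ Φ) (fun p => c (projIcc 0 1 zero_le_one (1 - p.2), γ p.1)) S := by
    rintro ⟨y, r⟩ ⟨hy, hr0, hr1⟩
    have hy1 : ‖y‖ = 1 := by simpa using hy
    have hy0 : y ≠ 0 := by rintro rfl; simp at hy1
    simp only at hr0 hr1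
    rcases hr0.eq_or_lt with rfl | hr
    · simp [R, Φ, hc1]
    · have hn : ‖r • y‖ = r := by rw [norm_smul, hy1, mul_one, Real.norm_of_nonneg hr0]
      simp only [R, Φ, Function.comp_apply, smul_eq_zero, hr.ne', hy0, or_self, if_false, hn,
        smul_smul, inv_mul_cancel₀ hr.ne', one_smul]
  have hRc : ContinuousOn R (Φ '' S) := by
    refine continuousOn_image_of_isCompact hSc (by fun_prop) (ContinuousOn.congr ?_ hRΦ)
    refine c.continuous.comp_continuousOn (ContinuousOn.prodMk ?_ ?_)
    · exact (continuous_projIcc.comp (continuous_const.sub continuous_snd)).continuousOn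
    · exact hγc.comp continuousOn_fst fun p hp => hp.1
  have hsub : closedBall 0 1 ⊆ Φ '' S := by
    intro y hy
    rw [mem_closedBall_zero_iff] at hy
    by_cases hy0 : y = 0
    · have : Nonempty (Fin m) := ⟨⟨0, hm⟩⟩
      refine ⟨(fun _ => 1, 0), ⟨?_, by simp⟩, by simp [Φ, hy0]⟩
      rw [mem_sphere_zero_iff_norm, pi_norm_const, norm_one]
    · have hn := norm_ne_zero_iff.2 hy0
      refine ⟨(‖y‖⁻¹ • y, ‖y‖), ⟨?_, norm_nonneg _, hy⟩, ?_⟩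
      · rw [mem_sphere_zero_iff_norm, norm_smul, norm_inv, norm_norm, inv_mul_cancel₀ hn]
      · simp only [Φ, smul_smul, mul_inv_cancel₀ hn, one_smul]
  refine ⟨fun y => R y, continuous_subtype_val.comp_continuousOn (hRc.mono hsub),
    fun y _ => (R y).2, fun y hy => ?_⟩
  have h := hRΦ (x := (y, 1)) ⟨hy, by simp⟩
  simp only [Function.comp_apply, Φ, one_smul, sub_self, projIcc_left] at h
  change ((R y : Z) : X) = g y
  rw [h, ← hγ y hy]
  exact congrArg _ (hc0 _)

variable {G X : Type*} [Group G] [TopologicalSpace X] [MulAction G X]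

theorem IsGCWComplex.isClosed_fixedPoints [CWComplex (univ : Set X)] (hX : IsGCWComplex G X)
    (L : Subgroup G) : IsClosed (MulAction.fixedPoints L X) := by
  have := hX.t2Space
  have : MulAction.fixedPoints L X = ⋂ g : L, {x | (g : G) • x = x} := by
    ext x
    simp [MulAction.mem_fixedPoints, Subgroup.smul_def]
  rw [this]
  exact isClosed_iInter fun g => isClosed_eq (hX.continuous_smul g) continuous_id

variable [CWComplex (univ : Set X)]

theorem exists_mem_openCell (x : X) :
    ∃ (m : ℕ) (e : cell (univ : Set X) m), x ∈ openCell m e := by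
  have : x ∈ ⋃ (m : ℕ) (e : cell (univ : Set X) m), openCell m e := by
    rw [CWComplex.iUnion_openCell_eq_complex]
    trivial
  simpa using this

/-- The fixed point set of a subgroup is a subcomplex. -/
theorem IsGCWComplex.exists_subcomplex_fixedPoints (hX : IsGCWComplex G X) (L : Subgroup G) :
    ∃ E : Subcomplex (univ : Set X), (E : Set X) = MulAction.fixedPoints L X := by
  refine ⟨⟨MulAction.fixedPoints L X, fun m => {e | openCell m e ⊆ MulAction.fixedPoints L X},
    hX.isClosed_fixedPoints L, ?_⟩, rfl⟩
  rw [empty_union]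
  refine subset_antisymm (iUnion₂_subset fun m e => e.2) fun x hx => ?_
  obtain ⟨m, e, he⟩ := exists_mem_openCell x
  refine mem_iUnion₂.2 ⟨m, ⟨e, fun y hy h => ?_⟩, he⟩
  refine hX.smul_eq_self h m e x he ?_ y hy
  have : (h : G) • x = x := hx h
  rwa [this]

variable [T2Space X]

theorem IsGCWComplex.smul_mem_skeletonLT (hX : IsGCWComplex G X) (g : G) {m : ℕ∞} {x : X}
    (hx : x ∈ skeletonLT (univ : Set X) m) : g • x ∈ skeletonLT (univ : Set X) m := by
  obtain ⟨l, hl, e, he⟩ := CWComplex.mem_skeletonLT_iff.1 hx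
  obtain ⟨e', he'⟩ := hX.smul_openCell g l e
  exact CWComplex.mem_skeletonLT_iff.2 ⟨l, hl, e', he' ▸ smul_mem_smul_set he⟩

theorem IsGCWComplex.smul_mem_closedCell (hX : IsGCWComplex G X) {g : G} {m : ℕ}
    {e e' : cell (univ : Set X) m} (h : g • openCell m e = openCell m e') {x : X}
    (hx : x ∈ closedCell m e) : g • x ∈ closedCell m e' := by
  rw [← closure_openCell_eq_closedCell] at hx ⊢
  exact map_mem_closure (hX.continuous_smul g) hx fun y hy => h ▸ smul_mem_smul_set hy

theorem mem_skeletonLT_succ_iff {m : ℕ} {x : X} :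
    x ∈ skeletonLT (univ : Set X) (m + 1 : ℕ) ↔ x ∈ skeletonLT (univ : Set X) m ∨
      ∃ e : cell (univ : Set X) m, x ∈ openCell m e := by
  rw [CWComplex.mem_skeletonLT_iff, CWComplex.mem_skeletonLT_iff]
  constructor
  · rintro ⟨l, hl, e, he⟩
    have hl' : l < m + 1 := by exact_mod_cast hl
    rcases (Nat.lt_succ_iff.1 hl').lt_or_eq with h | rfl
    · exact Or.inl ⟨l, by exact_mod_cast h, e, he⟩
    · exact Or.inr ⟨e, he⟩
  · rintro (⟨l, hl, e, he⟩ | ⟨e, he⟩)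
    · exact ⟨l, hl.trans (by exact_mod_cast Nat.lt_succ_self m), e, he⟩
    · exact ⟨m, by exact_mod_cast Nat.lt_succ_self m, e, he⟩

theorem notMem_skeletonLT_of_mem_openCell {m : ℕ} {x : X} {e : cell (univ : Set X) m}
    (hx : x ∈ openCell m e) : x ∉ skeletonLT (univ : Set X) m := fun h =>
  disjoint_left.1 (disjoint_skeletonLT_openCell le_rfl) h hx

/-- A map defined on a skeleton is continuous there if it is continuous on the closed cells. -/
theorem continuousOn_skeletonLT {Y : Type*} [TopologicalSpace Y] {f : X → Y} {m : ℕ}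
    (hf : ∀ l < m, ∀ e : cell (univ : Set X) l, ContinuousOn f (closedCell l e)) :
    ContinuousOn f (skeletonLT (univ : Set X) m) := by
  rw [continuousOn_iff_isClosed]
  intro t ht
  refine ⟨f ⁻¹' t ∩ skeletonLT (univ : Set X) m, ?_, by rw [inter_assoc, inter_self]⟩
  refine CWComplex.isClosed_of_disjoint_openCell_or_isClosed_inter_closedCell (C := univ)
    (subset_univ _) fun l _ e => ?_
  by_cases hl : l < m
  · right
    have hsub : closedCell l e ⊆ skeletonLT (univ : Set X) m :=
      (closedCell_subset_skeletonLT l e).trans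
        (skeletonLT_mono (by exact_mod_cast Nat.succ_le_of_lt hl))
    rw [inter_assoc, inter_eq_right.2 hsub, inter_comm]
    exact (hf l hl e).preimage_isClosed_of_isClosed isClosed_closedCell ht
  · left
    exact (disjoint_skeletonLT_openCell (by exact_mod_cast not_lt.1 hl)).mono_left
      inter_subset_right

variable {B : Type*} [Group B] [MulAction B X]

/-- One step of the construction of cellular twisted maps: the extension from the union of the
cells of dimension less than `m` to the cells of dimension `m`. -/
theorem exists_twisted_extension {φ : MulAut B} {F : Set (Subgroup B)}
    (hφ : IsInvariant φ F) {n : ℕ} (hX : IsModel B F X n) {m : ℕ} {f : X → X}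
    (hfc : ContinuousOn f (skeletonLT (univ : Set X) m))
    (hfs : ∀ (b : B), ∀ x ∈ skeletonLT (univ : Set X) m, f (b • x) = (φ⁻¹ : MulAut B) b • f x)
    (hfm : MapsTo f (skeletonLT (univ : Set X) m) (skeletonLT (univ : Set X) m)) :
    ∃ f' : X → X, ContinuousOn f' (skeletonLT (univ : Set X) (m + 1 : ℕ)) ∧
      (∀ (b : B), ∀ x ∈ skeletonLT (univ : Set X) (m + 1 : ℕ),
        f' (b • x) = (φ⁻¹ : MulAut B) b • f' x) ∧
      MapsTo f' (skeletonLT (univ : Set X) (m + 1 : ℕ)) (skeletonLT (univ : Set X) (m + 1 : ℕ)) ∧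
      EqOn f' f (skeletonLT (univ : Set X) m) := by
  classical
  have hG := hX.isGCWComplex
  have hmono : (skeletonLT (univ : Set X) m : Set X) ⊆ skeletonLT (univ : Set X) (m + 1 : ℕ) :=
    skeletonLT_mono (by exact_mod_cast Nat.le_succ m)
  -- the extension over single cells
  have hcell : ∀ e : cell (univ : Set X) m, ∃ g : (Fin m → ℝ) → X,
      ContinuousOn g (closedBall 0 1) ∧
      (∀ y ∈ closedBall (0 : Fin m → ℝ) 1, g y ∈ skeletonLT (univ : Set X) (m + 1 : ℕ) ∧
        ∀ b : B, (∀ x ∈ openCell m e, b • x = x) → (φ⁻¹ : MulAut B) b • g y = g y) ∧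
      ∀ y ∈ sphere (0 : Fin m → ℝ) 1, g y = f (map m e y) := by
    intro e
    -- Twisted equivariance forces the cell into the fixed points of `L = φ⁻¹(H)`, so the extension
    -- problem is posed inside that contractible set.
    set H : Subgroup B := fixingSubgroup B (openCell m e) with hH
    have hHmem : ∀ b, b ∈ H ↔ ∀ x ∈ openCell m e, b • x = x := fun b =>
      mem_fixingSubgroup_iff B
    have hHF : H ∈ F := by
      by_contra h
      have h0 := hX.fixedPoints_eq_empty H h
      have : map m e 0 ∈ MulAction.fixedPoints H X := fun b =>
        (hHmem b).1 b.2 _ (map_zero_mem_openCell m e)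
      rw [h0] at this
      exact this
    set L : Subgroup B := H.map (φ ^ (-1 : ℤ) : MulAut B).toMonoidHom with hL
    have hLF : L ∈ F := hφ (-1) H hHF
    have hLmem : ∀ x, x ∈ MulAction.fixedPoints L X ↔
        ∀ b ∈ H, (φ⁻¹ : MulAut B) b • x = x := by
      intro x
      constructor
      · intro h b hb
        exact h ⟨(φ⁻¹ : MulAut B) b, b, hb, by rw [zpow_neg_one]; rfl⟩
      · rintro h ⟨_, b, hb, rfl⟩
        have := h b hb
        rwa [← zpow_neg_one] at this
    have := hX.contractible L hLF
    have hsk : MapsTo (map m e) (sphere 0 1) (skeletonLT (univ : Set X) m) := fun y hy =>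
      cellFrontier_subset_skeletonLT m e (mem_image_of_mem _ hy)
    obtain ⟨g, hg, hgL, hgs⟩ := exists_extension_closedBall
      (Z := MulAction.fixedPoints L X) (g := f ∘ map m e)
      (hfc.comp ((RelCWComplex.continuousOn m e).mono sphere_subset_closedBall) hsk) (by
        intro y hy
        rw [hLmem]
        intro b hb
        rw [Function.comp_apply, ← hfs b _ (hsk hy)]
        congr 1
        have hclosed : IsClosed {x : X | b • x = x} :=
          isClosed_eq (hG.continuous_smul b) continuous_id
        have : closedCell m e ⊆ {x : X | b • x = x} := by
          rw [← closure_openCell_eq_closedCell]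
          exact hclosed.closure_subset_iff.2 ((hHmem b).1 hb)
        exact this (mem_image_of_mem _ (sphere_subset_closedBall hy)))
    -- As the fixed point set is a subcomplex, pushing into the `m`-skeleton stays in it.
    obtain ⟨E, hE⟩ := hG.exists_subcomplex_fixedPoints L
    obtain ⟨g', hg', hgg'⟩ := exists_push_into_skeleton (C := (univ : Set X)) (n + 1) g hg
      (fun y _ => by
        obtain ⟨l, e', he'⟩ := exists_mem_openCell (g y)
        refine CWComplex.mem_skeletonLT_iff.2 ⟨l, ?_, e', he'⟩
        have : ¬ n < l := fun h => (hX.hasDimension.isEmpty_cell l h).false e'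
        exact_mod_cast Nat.lt_succ_of_le (not_lt.1 this))
    refine ⟨g', hg', fun y hy => ⟨by exact_mod_cast (hgg' y hy).1, fun b hb => ?_⟩,
      fun y hy => ?_⟩
    · have h1 : g' y ∈ (E : Set X) := (hgg' y hy).2.2 E (by
        change g y ∈ (E : Set X)
        rw [hE]
        exact hgL hy)
      rw [hE, hLmem] at h1
      exact h1 b ((hHmem b).2 hb)
    · have h1 := hgs hy
      rw [(hgg' y (sphere_subset_closedBall hy)).2.1, h1]
      · rfl
      · rw [h1]
        exact_mod_cast hmono (hfm (hsk hy))
  choose g hgc hg hgs using hcell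
  -- representatives of the orbits of cells
  let r : Setoid (cell (univ : Set X) m) :=
    { r := fun e e' => ∃ b : B, b • openCell m e = openCell m e'
      iseqv := ⟨fun e => ⟨1, one_smul _ _⟩,
        fun {e e'} ⟨b, hb⟩ => ⟨b⁻¹, by rw [← hb, inv_smul_smul]⟩,
        fun {e e' e''} ⟨b, hb⟩ ⟨b', hb'⟩ => ⟨b' * b, by rw [mul_smul, hb, hb']⟩⟩ }
  let rep : cell (univ : Set X) m → cell (univ : Set X) m := fun e => (Quotient.mk r e).out
  have hrep : ∀ e, ∃ b : B, b • openCell m (rep e) = openCell m e := fun e =>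
    Quotient.mk_out (s := r) e
  choose β hβ using hrep
  have hrep_eq : ∀ (b : B) (e e' : cell (univ : Set X) m), b • openCell m e = openCell m e' →
      rep e' = rep e := fun b e e' h =>
    congrArg Quotient.out (Quotient.sound (s := r) ⟨b, h⟩).symm
  -- On an `m`-cell the value is dictated by equivariance from the representative of its orbit;
  -- `hf'new` shows that the translating element does not matter.
  let f' : X → X := fun x => if h : ∃ e : cell (univ : Set X) m, x ∈ openCell m e then
    (φ⁻¹ : MulAut B) (β h.choose) •
      g (rep h.choose) ((map m (rep h.choose)).symm ((β h.choose)⁻¹ • x)) else f x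
  have hball : ∀ (e : cell (univ : Set X) m), ∀ x ∈ openCell m e,
      (map m e).symm x ∈ ball (0 : Fin m → ℝ) 1 := by
    rintro e _ ⟨z, hz, rfl⟩
    rwa [(map m e).left_inv (by rwa [source_eq])]
  have hf'old : EqOn f' f (skeletonLT (univ : Set X) m) := fun x hx =>
    dif_neg fun ⟨e, he⟩ => notMem_skeletonLT_of_mem_openCell he hx
  have hf'new : ∀ (e : cell (univ : Set X) m) (b : B), b • openCell m (rep e) = openCell m e →
      ∀ x ∈ openCell m e,
      f' x = (φ⁻¹ : MulAut B) b • g (rep e) ((map m (rep e)).symm (b⁻¹ • x)) := by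
    intro e b hb x hx
    have hex : ∃ e : cell (univ : Set X) m, x ∈ openCell m e := ⟨e, hx⟩
    have hch : hex.choose = e := by
      have := eq_of_not_disjoint_openCell (not_disjoint_iff.2 ⟨x, hex.choose_spec, hx⟩)
      simpa using this
    have hbx : b⁻¹ • x ∈ openCell m (rep e) := by
      rw [← mem_smul_set_iff_inv_smul_mem, hb]; exact hx
    have hβx : (β e)⁻¹ • x ∈ openCell m (rep e) := by
      rw [← mem_smul_set_iff_inv_smul_mem, hβ]; exact hx
    -- Two elements carrying the representative to `e` differ by one preserving the cell, hence
    -- fixing it pointwise; its image under `φ⁻¹` then fixes the values of `g`.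
    have hfix : ∀ y ∈ openCell m (rep e), (b⁻¹ * β e) • y = y := by
      refine hG.smul_eq_self (b⁻¹ * β e) m (rep e) _ hβx ?_
      rw [mul_smul, smul_inv_smul]
      exact hbx
    have h1 : (β e)⁻¹ • x = b⁻¹ • x := by
      rw [← hfix _ hβx, mul_smul, smul_inv_smul]
    have h2 := (hg (rep e) _ (ball_subset_closedBall (hball _ _ hbx))).2 _ hfix
    simp only [f', dif_pos hex, hch, h1]
    rw [map_mul, mul_smul, map_inv, inv_smul_eq_iff] at h2
    exact h2
  have hf's : ∀ (b : B), ∀ x ∈ skeletonLT (univ : Set X) (m + 1 : ℕ),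
      f' (b • x) = (φ⁻¹ : MulAut B) b • f' x := by
    intro b x hx
    rcases mem_skeletonLT_succ_iff.1 hx with hx | ⟨e, he⟩
    · rw [hf'old hx, hf'old (hG.smul_mem_skeletonLT b hx), hfs b x hx]
    · obtain ⟨e', he'⟩ := hG.smul_openCell b m e
      have hbe : (b * β e) • openCell m (rep e') = openCell m e' := by
        rw [hrep_eq b e e' he', mul_smul, hβ, he']
      rw [hf'new e (β e) (hβ e) x he,
        hf'new e' (b * β e) hbe (b • x) (he' ▸ smul_mem_smul_set he), map_mul, mul_smul,
        hrep_eq b e e' he', mul_inv_rev, mul_smul, inv_smul_smul]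
  refine ⟨f', ?_, hf's, ?_, hf'old⟩
  · refine continuousOn_skeletonLT fun l hl e => ?_
    rcases (Nat.lt_succ_iff.1 hl).lt_or_eq with hl | rfl
    · have hsub : closedCell l e ⊆ skeletonLT (univ : Set X) m :=
        (closedCell_subset_skeletonLT l e).trans
          (skeletonLT_mono (by exact_mod_cast Nat.succ_le_of_lt hl))
      exact (hfc.mono hsub).congr (hf'old.mono hsub)
    -- Continuity is proved on the representative, where the composition with the characteristic map
    -- is `g`, and then translated to `e`.
    · have hrr : rep (rep e) = rep e := (hrep_eq (β e) (rep e) e (hβ e)).symm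
      have hrc : ContinuousOn f' (closedCell l (rep e)) := by
        refine continuousOn_image_of_isCompact (isCompact_closedBall _ _)
          (RelCWComplex.continuousOn l (rep e)) ((hgc (rep e)).congr fun y hy => ?_)
        rw [Function.comp_apply]
        rcases (mem_closedBall_zero_iff.1 hy).lt_or_eq with hy1 | hy1
        · have hyb : y ∈ ball (0 : Fin l → ℝ) 1 := mem_ball_zero_iff.2 hy1
          rw [hf'new (rep e) 1 (by rw [hrr, one_smul]) _ (mem_image_of_mem _ hyb), map_one,
            one_smul, inv_one, one_smul, hrr, (map l (rep e)).left_inv (by rwa [source_eq])]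
        · have hys : y ∈ sphere (0 : Fin l → ℝ) 1 := mem_sphere_zero_iff_norm.2 hy1
          rw [hgs (rep e) y hys]
          exact hf'old (cellFrontier_subset_skeletonLT l _ (mem_image_of_mem _ hys))
      have hinv : (β e)⁻¹ • openCell l e = openCell l (rep e) := by
        rw [← hβ e, inv_smul_smul]
      have hmaps : MapsTo (fun x => (β e)⁻¹ • x) (closedCell l e) (closedCell l (rep e)) :=
        fun x hx => hG.smul_mem_closedCell hinv hx
      refine (((hG.continuous_smul ((φ⁻¹ : MulAut B) (β e))).comp_continuousOn
        (hrc.comp (hG.continuous_smul (β e)⁻¹).continuousOn hmaps))).congr fun x hx => ?_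
      have hx' : (β e)⁻¹ • x ∈ skeletonLT (univ : Set X) (l + 1 : ℕ) := by
        exact_mod_cast closedCell_subset_skeletonLT l _ (hmaps hx)
      have := hf's (β e) _ hx'
      rwa [smul_inv_smul] at this
  · intro x hx
    rcases mem_skeletonLT_succ_iff.1 hx with hx | ⟨e, he⟩
    · rw [hf'old hx]
      exact hmono (hfm hx)
    · rw [hf'new e (β e) (hβ e) x he]
      refine hG.smul_mem_skeletonLT _ (hg (rep e) _ (ball_subset_closedBall (hball _ _ ?_))).1
      rw [← mem_smul_set_iff_inv_smul_mem, hβ]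
      exact he

/-- A model for `E_F B` admits a cellular twisted self-map. -/
theorem exists_isCellular_twistedMap {φ : MulAut B} {F : Set (Subgroup B)}
    (hφ : IsInvariant φ F) {n : ℕ} (hX : IsModel B F X n) :
    ∃ f : TwistedMap φ X, IsCellular f.toFun := by
  have key : ∀ m : ℕ, ∃ f : X → X, ContinuousOn f (skeletonLT (univ : Set X) m) ∧
      (∀ (b : B), ∀ x ∈ skeletonLT (univ : Set X) m, f (b • x) = (φ⁻¹ : MulAut B) b • f x) ∧
      ∀ l : ℕ, l ≤ m → MapsTo f (skeletonLT (univ : Set X) l) (skeletonLT (univ : Set X) l) := by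
    intro m
    induction m with
    | zero =>
      have h0 : ∀ x : X, x ∉ skeletonLT (univ : Set X) (0 : ℕ) := fun x hx => by
        obtain ⟨l, hl, -⟩ := CWComplex.mem_skeletonLT_iff.1 hx
        simp at hl
      refine ⟨id, continuousOn_id, fun b x hx => absurd hx (h0 x), fun l hl => mapsTo_id _⟩
    | succ m ih =>
      obtain ⟨f, hfc, hfs, hfm⟩ := ih
      obtain ⟨f', hfc', hfs', hfm', hff'⟩ :=
        exists_twisted_extension hφ hX hfc hfs (hfm m le_rfl)
      refine ⟨f', hfc', hfs', fun l hl => ?_⟩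
      rcases hl.lt_or_eq with hl | rfl
      · have hl' := Nat.lt_succ_iff.1 hl
        exact (hfm l hl').congr
          (hff'.symm.mono (skeletonLT_mono (by exact_mod_cast hl')))
      · exact hfm'
  -- `skeletonLT` uses cells of dimension strictly below its index, so index `n + 1` already gives
  -- all of `X`.
  obtain ⟨f, hfc, hfs, hfm⟩ := key (n + 1)
  have htop : ∀ x : X, x ∈ skeletonLT (univ : Set X) (n + 1 : ℕ) := fun x => by
    obtain ⟨l, e', he'⟩ := exists_mem_openCell x
    refine CWComplex.mem_skeletonLT_iff.2 ⟨l, ?_, e', he'⟩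
    have : ¬ n < l := fun h => (hX.hasDimension.isEmpty_cell l h).false e'
    exact_mod_cast Nat.lt_succ_of_le (not_lt.1 this)
  refine ⟨⟨f, ?_, fun b x => hfs b x (htop x)⟩, fun m x hx => ?_⟩
  · rw [← continuousOn_univ]
    exact hfc.mono fun x _ => htop x
  · by_cases hm : m + 1 ≤ n + 1
    · exact_mod_cast hfm (m + 1) hm (by exact_mod_cast hx)
    · exact skeletonLT_mono (by exact_mod_cast (not_le.1 hm).le) (htop (f x))

end EquivariantExtension

/-! ### Contractibility of telescopes of contractible spaces -/

section FamilyTelescope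

variable {S : ℤ → Type*}

/-- The gluing of the telescope of a sequence of maps `S k → S (k + 1)`. -/
inductive FamilyTelescopeRel (f : ∀ k, S k → S (k + 1)) :
    (Σ k, S k × I) → (Σ k, S k × I) → Prop
  | glue (k : ℤ) (x : S k) : FamilyTelescopeRel f ⟨k, x, 1⟩ ⟨k + 1, f k x, 0⟩

/-- The bi-infinite mapping telescope of a sequence of maps `S k → S (k + 1)`. -/
def FamilyTelescope (f : ∀ k, S k → S (k + 1)) : Type _ := Quot (FamilyTelescopeRel f)

variable [∀ k, TopologicalSpace (S k)]

instance (f : ∀ k, S k → S (k + 1)) : TopologicalSpace (FamilyTelescope f) :=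
  inferInstanceAs (TopologicalSpace (Quot (FamilyTelescopeRel f)))

namespace FamilyTelescope

variable {f : ∀ k, S k → S (k + 1)}

variable (f) in
/-- The class of the point `(x, t)` of the `k`-th cylinder. -/
def mk (k : ℤ) (p : S k × I) : FamilyTelescope f := Quot.mk _ ⟨k, p⟩

omit [∀ k, TopologicalSpace (S k)] in
theorem glue (k : ℤ) (x : S k) : mk f k (x, 1) = mk f (k + 1) (f k x, 0) :=
  Quot.sound (FamilyTelescopeRel.glue k x)

omit [∀ k, TopologicalSpace (S k)] in
theorem exists_eq_mk (p : FamilyTelescope f) : ∃ k x t, p = mk f k (x, t) := by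
  obtain ⟨k, x, t⟩ := p
  exact ⟨k, x, t, rfl⟩

theorem continuous_mk (k : ℤ) : Continuous (mk f k) :=
  continuous_quot_mk.comp continuous_sigmaMk

/-- Compatible homotopies on the cylinders induce a homotopy on the telescope. -/
theorem exists_homotopy {W : Type*} [TopologicalSpace W] (H : ∀ k, S k × I → I → W)
    (hc : ∀ k, Continuous fun p : (S k × I) × I => H k p.1 p.2)
    (hrel : ∀ k x s, H k (x, 1) s = H (k + 1) (f k x, 0) s) :
    ∃ H' : C(I × FamilyTelescope f, W), ∀ s k p, H' (s, mk f k p) = H k p s := by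
  -- Currying reduces continuity on the product of `I` with a quotient to continuity on the quotient
  -- itself.
  let h : ∀ k, C(S k × I, C(I, W)) := fun k =>
    ContinuousMap.curry ⟨fun p : (S k × I) × I => H k p.1 p.2, hc k⟩
  let h' : (Σ k, S k × I) → C(I, W) := fun p => h p.1 p.2
  have hh' : Continuous h' := continuous_sigma fun k => (h k).continuous
  have hr : ∀ p q, FamilyTelescopeRel f p q → h' p = h' q := by
    rintro _ _ ⟨k, x⟩
    ext s
    exact hrel k x s
  let L : C(FamilyTelescope f, C(I, W)) := ⟨Quot.lift h' hr, continuous_quot_lift hr hh'⟩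
  exact ⟨L.uncurry.comp ⟨Prod.swap, continuous_swap⟩, fun s k p => rfl⟩

/-- The height function of a telescope. -/
theorem exists_height : ∃ h : C(FamilyTelescope f, ℝ), ∀ k x t, h (mk f k (x, t)) = k + t := by
  obtain ⟨H, hH⟩ := exists_homotopy (f := f) (W := ℝ) (fun k p _ => k + p.2)
    (fun k => by fun_prop) (fun k x s => by simp)
  exact ⟨H.comp ⟨fun p => (0, p), by fun_prop⟩, fun k x t => hH 0 k (x, t)⟩

end FamilyTelescope

theorem locallyFinite_Icc_int : LocallyFinite fun k : ℤ => Icc (k : ℝ) (k + 1) := by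
  intro x
  refine ⟨Ioo (x - 1) (x + 1), Ioo_mem_nhds (by linarith) (by linarith),
    (finite_Icc ⌊x - 2⌋ ⌈x + 1⌉).subset ?_⟩
  rintro k ⟨y, ⟨h1, h2⟩, h3, h4⟩
  constructor
  · have : (⌊x - 2⌋ : ℝ) ≤ x - 2 := Int.floor_le _
    exact_mod_cast (by linarith : (⌊x - 2⌋ : ℝ) ≤ k)
  · have : x + 1 ≤ (⌈x + 1⌉ : ℝ) := Int.le_ceil _
    exact_mod_cast (by linarith : (k : ℝ) ≤ ⌈x + 1⌉)

/-- Paths `γ k` with `γ k 1 = γ (k + 1) 0` can be joined to a map from the real line. -/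
theorem exists_continuous_real {W : Type*} [TopologicalSpace W] (γ : ℤ → I → W)
    (hγ : ∀ k, Continuous (γ k)) (h : ∀ k, γ k 1 = γ (k + 1) 0) :
    ∃ s : C(ℝ, W), ∀ (k : ℤ) (t : I), s (k + t) = γ k t := by
  let s : ℝ → W := fun r => γ ⌊r⌋ ⟨Int.fract r, Int.fract_nonneg r, (Int.fract_lt_one r).le⟩
  have hs : ∀ (k : ℤ) (t : I), s (k + t) = γ k t := by
    intro k t
    rcases t.2.2.lt_or_eq with ht | ht
    · have h1 : ⌊(k + t : ℝ)⌋ = k := by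
        rw [Int.floor_intCast_add, Int.floor_eq_zero_iff.2 ⟨t.2.1, ht⟩, add_zero]
      have h2 : Int.fract (k + t : ℝ) = t := by
        rw [Int.fract, h1]; ring
      simp only [s, h1, h2]
    · have ht1 : t = 1 := Subtype.ext ht
      subst ht1
      have h1 : (k + ((1 : I) : ℝ) : ℝ) = ((k + 1 : ℤ) : ℝ) := by push_cast; rfl
      simp only [s, h1, Int.floor_intCast, Int.fract_intCast, h]
      rfl
  refine ⟨⟨s, ?_⟩, hs⟩
  refine locallyFinite_Icc_int.continuous ?_ (fun k => isClosed_Icc) fun k => ?_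
  · refine eq_univ_of_forall fun r => mem_iUnion.2 ⟨⌊r⌋, Int.floor_le r, ?_⟩
    exact (Int.lt_floor_add_one r).le
  · have : ContinuousOn (fun r : ℝ => γ k (projIcc 0 1 zero_le_one (r - k))) (Icc k (k + 1)) :=
      ((hγ k).comp (continuous_projIcc.comp (continuous_id.sub continuous_const))).continuousOn
    refine this.congr fun r hr => ?_
    simp only
    rw [projIcc_of_mem zero_le_one (show r - k ∈ Icc (0 : ℝ) 1 from
      ⟨by linarith [hr.1], by linarith [hr.2]⟩), ← hs]
    simp

/-- The telescope of a sequence of contractible spaces is contractible. -/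
theorem contractibleSpace_familyTelescope {f : ∀ k, S k → S (k + 1)}
    (hf : ∀ k, Continuous (f k)) [∀ k, ContractibleSpace (S k)] :
    ContractibleSpace (FamilyTelescope f) := by
  choose a c using fun k => id_nullhomotopic (S k)
  replace c := fun k => (c k).some
  have hc0 : ∀ k z, c k (0, z) = z := fun k z => (c k).apply_zero z
  have hc1 : ∀ k z, c k (1, z) = a k := fun k z => (c k).apply_one z
  have hcc : ∀ k, Continuous (c k) := fun k => (c k).continuous
  let P : ℝ → I := projIcc 0 1 zero_le_one
  have hP : Continuous P := continuous_projIcc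
  have hP0 : P 0 = 0 := projIcc_left zero_le_one
  have hP1 : ∀ r, 1 ≤ r → P r = 1 := fun r hr => projIcc_of_right_le zero_le_one hr
  have hPs : ∀ s : I, P s = s := fun s => projIcc_val zero_le_one s
  -- First deformation: at `s = 1` the lower half of each cylinder is stretched over the whole and
  -- the upper half is collapsed to the top. This frees the upper half for interpolation.
  obtain ⟨H₁, hH₁⟩ := FamilyTelescope.exists_homotopy (f := f)
    (fun k p s => FamilyTelescope.mk f k (p.1, P ((1 + s) * p.2)))
    (fun k => (FamilyTelescope.continuous_mk k).comp (by fun_prop)) (fun k x s => by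
      simp only [Icc.coe_one, mul_one, Icc.coe_zero, mul_zero, hP0,
        hP1 (1 + s) (by linarith [s.2.1])]
      exact FamilyTelescope.glue k x)
  -- The lower half contracts by `c k`. On the upper half, at the bottom of the next cylinder, `f ∘
  -- c k` at `t = 1/2` is interpolated to `c (k + 1) ∘ f` at `t = 1`, as the gluing demands. At `s =
  -- 1` one of the two contractions is complete on either side of `t = 3/4`, so the result is
  -- independent of `x`.
  let K : ∀ k, S k × I → I → FamilyTelescope f := fun k p s =>
    if (p.2 : ℝ) ≤ 1 / 2 then FamilyTelescope.mk f k (c k (s, p.1), P (2 * p.2))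
    else FamilyTelescope.mk f (k + 1)
      (c (k + 1) (P (s * min 1 (4 * (p.2 : ℝ) - 2)), f k (c k (P (s * min 1 (4 - 4 * (p.2 : ℝ))), p.1))), 0)
  have hKc : ∀ k, Continuous fun p : (S k × I) × I => K k p.1 p.2 := by
    intro k
    have := hf k
    have := hcc k
    have := hcc (k + 1)
    refine Continuous.if_le ((FamilyTelescope.continuous_mk k).comp (by fun_prop))
      ((FamilyTelescope.continuous_mk (k + 1)).comp (by fun_prop)) (by fun_prop) (by fun_prop) ?_
    rintro ⟨⟨x, t⟩, s⟩ ht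
    simp only at ht
    simp only [ht]
    norm_num [hP0, hP1, hc0, hPs]
    exact FamilyTelescope.glue k _
  obtain ⟨H₂, hH₂⟩ := FamilyTelescope.exists_homotopy (f := f) K hKc (fun k x s => by
    norm_num [K, hP0, hc0, hPs])
  let γ : ℤ → I → FamilyTelescope f := fun k t => K k (a k, t) 1
  have hKγ : ∀ k x t, K k (x, t) 1 = γ k t := by
    intro k x t
    simp only [γ, K, hc1, Icc.coe_one, one_mul]
    split_ifs with h
    · rfl
    · rcases le_total (t : ℝ) (3 / 4) with h' | h'
      · rw [min_eq_left (by linarith : (1 : ℝ) ≤ 4 - 4 * t), hP1 1 le_rfl, hc1, hc1]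
      · rw [min_eq_left (by linarith : (1 : ℝ) ≤ 4 * t - 2), hP1 1 le_rfl, hc1, hc1]
  obtain ⟨s, hs⟩ := exists_continuous_real γ
    (fun k => (hKc k).comp (by fun_prop : Continuous fun t : I => (((a k, t), 1) : (S k × I) × I)))
    (fun k => by
      change K k (a k, 1) 1 = γ (k + 1) 0
      rw [← hKγ (k + 1) (f k (a k)) 0, ← hH₂, ← hH₂, FamilyTelescope.glue])
  obtain ⟨h, hh⟩ := FamilyTelescope.exists_height (f := f)
  let q : C(FamilyTelescope f, FamilyTelescope f) := H₁.comp ⟨fun p => (1, p), by fun_prop⟩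
  have e1 : (ContinuousMap.id (FamilyTelescope f)).Homotopic q := by
    refine ⟨⟨H₁, fun p => ?_, fun p => rfl⟩⟩
    obtain ⟨k, x, t, rfl⟩ := FamilyTelescope.exists_eq_mk p
    simp [hH₁, hPs]
  have e2 : q.Homotopic (s.comp h) := by
    refine ⟨⟨H₂, fun p => ?_, fun p => ?_⟩⟩
    · obtain ⟨k, x, t, rfl⟩ := FamilyTelescope.exists_eq_mk p
      have : q (FamilyTelescope.mk f k (x, t)) =
          FamilyTelescope.mk f k (x, P ((1 + (1 : I)) * t)) := hH₁ 1 k (x, t)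
      simp only [ContinuousMap.toFun_eq_coe, this, hH₂, K]
      rw [Icc.coe_one, one_add_one_eq_two]
      split_ifs with h
      · rw [hc0]
      · rw [hP1 (2 * t) (by linarith), FamilyTelescope.glue, Icc.coe_zero, zero_mul, zero_mul,
          hP0, hc0, hc0]
    · obtain ⟨k, x, t, rfl⟩ := FamilyTelescope.exists_eq_mk p
      simp [hH₂, hKγ, hh, hs]
  rw [contractible_iff_id_nullhomotopic]
  obtain ⟨y, hy⟩ := ((id_nullhomotopic ℝ).comp_right s).comp_left h
  exact ⟨y, e1.trans (e2.trans hy)⟩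

end FamilyTelescope

/-! ### Topology and coordinates of the telescope -/

theorem continuous_int_prod {Y Z : Type*} [TopologicalSpace Y] [TopologicalSpace Z]
    {g : ℤ × Y → Z} (h : ∀ k, Continuous fun y => g (k, y)) : Continuous g :=
  continuous_prod_of_discrete_left.2 h

theorem isClosed_int_prod {Y : Type*} [TopologicalSpace Y] {A : Set (ℤ × Y)}
    (h : ∀ k, IsClosed {y | (k, y) ∈ A}) : IsClosed A := by
  rw [← isOpen_compl_iff, isOpen_iff_continuous_mem]
  exact continuous_int_prod fun k => isOpen_iff_continuous_mem.1 (h k).isOpen_compl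

namespace Telescope

variable {B X : Type*} [Group B] [TopologicalSpace X] [MulAction B X] {φ : MulAut B}
variable {f : TwistedMap φ X}

variable (f) in
/-- The class of the point `(x, t)` of the `k`-th cylinder. -/
def mk (k : ℤ) (x : X) (t : I) : Telescope f := Quot.mk _ (k, x, t)

theorem glue (k : ℤ) (x : X) : mk f k x 1 = mk f (k + 1) (f.toFun x) 0 :=
  Quot.sound (TelescopeRel.glue k x)

theorem continuous_mk (k : ℤ) : Continuous fun p : X × I => mk f k p.1 p.2 :=
  continuous_quot_mk.comp (by fun_prop)

theorem isClosed_iff {A : Set (Telescope f)} :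
    IsClosed A ↔ ∀ k, IsClosed {p : X × I | mk f k p.1 p.2 ∈ A} := by
  refine ⟨fun h k => h.preimage (continuous_mk k), fun h => ?_⟩
  refine (isQuotientMap_quot_mk (r := TelescopeRel f)).isClosed_preimage.1 ?_
  exact isClosed_int_prod h

theorem continuous_iff {Y : Type*} [TopologicalSpace Y] {g : Telescope f → Y} :
    Continuous g ↔ ∀ k, Continuous fun p : X × I => g (mk f k p.1 p.2) := by
  refine ⟨fun h k => h.comp (continuous_mk k), fun h => ?_⟩
  exact (isQuotientMap_quot_mk (r := TelescopeRel f)).continuous_iff.2 (continuous_int_prod h)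

variable (f) in
/-- The height function of the telescope. -/
def height : Telescope f → ℝ := Quot.lift (fun p => p.1 + p.2.2) (by
  rintro _ _ ⟨k, x⟩
  simp)

@[simp]
theorem height_mk (k : ℤ) (x : X) (t : I) : height f (mk f k x t) = k + t := rfl

theorem continuous_height : Continuous (height f) :=
  continuous_iff.2 fun k => by simp only [height_mk]; fun_prop

variable (f) in
/-- The points of height in `(k - 1, k + 1)` which flow to a point of `U` in the `k`-th cylinder. -/
def tube (k : ℤ) (U : Set X) : Set (Telescope f) :=
  {p | Quot.lift (fun q : ℤ × X × I => (q.1 = k ∧ q.2.2 < 1 ∧ q.2.1 ∈ U) ∨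
    (q.1 + 1 = k ∧ 0 < q.2.2 ∧ f.toFun q.2.1 ∈ U)) (by
      rintro _ _ ⟨k, x⟩
      simp) p}

theorem mk_mem_tube {k j : ℤ} {x : X} {t : I} {U : Set X} :
    mk f j x t ∈ tube f k U ↔ (j = k ∧ t < 1 ∧ x ∈ U) ∨ (j + 1 = k ∧ 0 < t ∧ f.toFun x ∈ U) :=
  Iff.rfl

theorem isOpen_tube (k : ℤ) {U : Set X} (hU : IsOpen U) : IsOpen (tube f k U) := by
  rw [← isClosed_compl_iff, isClosed_iff]
  intro j
  simp only [mem_compl_iff, mk_mem_tube, not_or]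
  have h1 : IsOpen {p : X × I | j = k ∧ p.2 < 1 ∧ p.1 ∈ U} :=
    isOpen_const.and ((isOpen_lt continuous_snd continuous_const).and (hU.preimage continuous_fst))
  have h2 : IsOpen {p : X × I | j + 1 = k ∧ 0 < p.2 ∧ f.toFun p.1 ∈ U} :=
    isOpen_const.and ((isOpen_lt continuous_const continuous_snd).and
      (hU.preimage (f.continuous_toFun.comp continuous_fst)))
  exact h1.isClosed_compl.inter h2.isClosed_compl

theorem exists_rep (p : Telescope f) : ∃ (k : ℤ) (x : X) (t : I), t < 1 ∧ p = mk f k x t := by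
  obtain ⟨k, x, t⟩ := p
  rcases lt_or_eq_of_le (show t ≤ 1 from t.2.2) with ht | rfl
  · exact ⟨k, x, t, ht, rfl⟩
  · exact ⟨k + 1, f.toFun x, 0, zero_lt_one, glue k x⟩

theorem eq_of_height_eq {k k' : ℤ} {t t' : I} (ht : t < 1) (ht' : t' < 1)
    (h : (k : ℝ) + t = k' + t') : k = k' ∧ t = t' := by
  have e : ∀ (k : ℤ) (t : I), t < 1 → ⌊(k : ℝ) + t⌋ = k := fun k t ht => by
    rw [Int.floor_intCast_add, Int.floor_eq_zero_iff.2 ⟨t.2.1, ht⟩, add_zero]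
  have hk : k = k' := by rw [← e k t ht, ← e k' t' ht', h]
  subst hk
  exact ⟨rfl, Subtype.ext (add_left_cancel h)⟩

theorem mk_injective {k k' : ℤ} {x x' : X} {t t' : I} (ht : t < 1) (ht' : t' < 1)
    (h : mk f k x t = mk f k' x' t') : k = k' ∧ x = x' ∧ t = t' := by
  obtain ⟨rfl, rfl⟩ := eq_of_height_eq ht ht' (congrArg (height f) h)
  -- The tube over a single point serves only as a predicate compatible with the gluing that detects
  -- the first coordinate.
  have : mk f k x t ∈ tube f k {x'} := by
    rw [h, mk_mem_tube]
    exact Or.inl ⟨rfl, ht, rfl⟩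
  rw [mk_mem_tube] at this
  rcases this with ⟨-, -, h⟩ | ⟨h, -⟩
  · exact ⟨rfl, h, rfl⟩
  · exact absurd h (by simp)

/-- Points of different heights are separated by the height, points of equal height by tubes over
disjoint open sets of `X`. -/
instance [T2Space X] : T2Space (Telescope f) := by
  refine ⟨fun p q hpq => ?_⟩
  by_cases hh : height f p = height f q
  · obtain ⟨k, x, t, ht, rfl⟩ := exists_rep p
    obtain ⟨k', x', t', ht', rfl⟩ := exists_rep q
    obtain ⟨rfl, rfl⟩ := eq_of_height_eq ht ht' hh
    have hx : x ≠ x' := by rintro rfl; exact hpq rfl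
    obtain ⟨U, V, hU, hV, hxU, hxV, hUV⟩ := t2_separation hx
    refine ⟨tube f k U, tube f k V, isOpen_tube k hU, isOpen_tube k hV,
      mk_mem_tube.2 (Or.inl ⟨rfl, ht, hxU⟩), mk_mem_tube.2 (Or.inl ⟨rfl, ht', hxV⟩), ?_⟩
    rw [disjoint_left] at hUV ⊢
    rintro ⟨j, y, s⟩ (⟨h1, -, h2⟩ | ⟨h1, -, h2⟩) (⟨h3, -, h4⟩ | ⟨h3, -, h4⟩)
    · exact hUV h2 h4
    · exact absurd (h1.trans h3.symm) (by simp)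
    · exact absurd (h3.trans h1.symm) (by simp)
    · exact hUV h2 h4
  · obtain ⟨U, V, hU, hV, hpU, hqV, hUV⟩ := t2_separation hh
    exact ⟨_, _, hU.preimage continuous_height, hV.preimage continuous_height, hpU, hqV,
      hUV.preimage _⟩

/-- The cylinder containing a point of the telescope, which is not at its top. -/
noncomputable def index (p : Telescope f) : ℤ := (exists_rep p).choose

/-- The first coordinate of a point of the telescope. -/
noncomputable def base (p : Telescope f) : X := (exists_rep p).choose_spec.choose

/-- The second coordinate of a point of the telescope. -/
noncomputable def time (p : Telescope f) : I := (exists_rep p).choose_spec.choose_spec.choose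

theorem time_lt_one (p : Telescope f) : time p < 1 :=
  (exists_rep p).choose_spec.choose_spec.choose_spec.1

theorem mk_coord (p : Telescope f) : mk f (index p) (base p) (time p) = p :=
  (exists_rep p).choose_spec.choose_spec.choose_spec.2.symm

theorem coord_mk (k : ℤ) (x : X) {t : I} (ht : t < 1) :
    index (mk f k x t) = k ∧ base (mk f k x t) = x ∧ time (mk f k x t) = t :=
  mk_injective (time_lt_one _) ht (mk_coord _)

/-- Where the index is `k`, the open tube over `U` is exactly the preimage of `U`. Across a seam the
coordinate `base` may jump from `x` to `f x`. -/
theorem continuousOn_base (k : ℤ) : ContinuousOn (base (f := f)) {p | index p = k} := by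
  rw [continuousOn_iff']
  intro U hU
  refine ⟨tube f k U, isOpen_tube k hU, ?_⟩
  ext p
  simp only [mem_inter_iff, mem_preimage, mem_ofPred_eq]
  refine and_congr_left fun hp => ?_
  conv_rhs => rw [← mk_coord p, mk_mem_tube, hp]
  simp [time_lt_one p]

theorem continuousOn_time (k : ℤ) : ContinuousOn (time (f := f)) {p | index p = k} := by
  rw [IsInducing.subtypeVal.continuousOn_iff]
  have : ContinuousOn (fun p => height f p - k) {p | index p = k} :=
    (continuous_height.sub continuous_const).continuousOn
  refine this.congr fun p hp => ?_
  have h : height f p = index p + time p := by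
    conv_lhs => rw [← mk_coord p, height_mk]
  change (time p : ℝ) = height f p - k
  rw [h, show index p = k from hp]
  ring

end Telescope

/-! ### The CW structure of the telescope -/

/-- In the product of a CW-complex with the unit interval, a set is closed if its intersections
with the products of closed cells with the interval are closed. -/
theorem isClosed_prod_unitInterval {X : Type*} [TopologicalSpace X] [T2Space X]
    [CWComplex (univ : Set X)] {A : Set (X × I)}
    (h : ∀ (n : ℕ) (e : RelCWComplex.cell (univ : Set X) n),
      IsClosed (A ∩ RelCWComplex.closedCell n e ×ˢ univ)) : IsClosed A := by
  rw [← isOpen_compl_iff, isOpen_iff_mem_nhds]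
  rintro ⟨x₀, t₀⟩ hx₀
  obtain ⟨m, e, he⟩ := exists_mem_openCell x₀
  have hslice : IsClosed {t : I | (x₀, t) ∈ A} := by
    have := (h m e).preimage (by fun_prop : Continuous fun t : I => (x₀, t))
    convert this using 1
    ext t
    simp [RelCWComplex.openCell_subset_closedCell m e he]
  -- Tube lemma argument: over a compact neighbourhood `J` of `t₀`, the projection of `A` to `X` is
  -- closed because it is so on each compact closed cell.
  obtain ⟨J, hJ, hJA, hJc⟩ := local_compact_nhds (hslice.isOpen_compl.mem_nhds hx₀)
  have hN : IsClosed (Prod.fst '' (A ∩ univ ×ˢ J)) := by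
    rw [CWComplex.closed univ _ (subset_univ _)]
    intro n e
    have : Prod.fst '' (A ∩ univ ×ˢ J) ∩ RelCWComplex.closedCell n e =
        Prod.fst '' ((RelCWComplex.closedCell n e ×ˢ J) ∩
          (A ∩ RelCWComplex.closedCell n e ×ˢ univ)) := by
      ext x
      constructor
      · rintro ⟨⟨⟨y, t⟩, ⟨hA, -, ht⟩, rfl⟩, hy⟩
        exact ⟨(y, t), ⟨⟨hy, ht⟩, hA, hy, trivial⟩, rfl⟩
      · rintro ⟨⟨y, t⟩, ⟨⟨hy, ht⟩, hA, -⟩, rfl⟩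
        exact ⟨⟨(y, t), ⟨hA, trivial, ht⟩, rfl⟩, hy⟩
    rw [this]
    exact (((RelCWComplex.isCompact_closedCell.prod hJc).inter_right (h n e)).image
      continuous_fst).isClosed
  have hx₀N : x₀ ∉ Prod.fst '' (A ∩ univ ×ˢ J) := by
    rintro ⟨⟨y, t⟩, ⟨hA, -, ht⟩, rfl⟩
    exact hJA ht hA
  filter_upwards [prod_mem_nhds (hN.isOpen_compl.mem_nhds hx₀N) hJ]
  rintro ⟨y, t⟩ ⟨hy, ht⟩ hA
  exact hy ⟨(y, t), ⟨hA, trivial, ht⟩, rfl⟩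

open Metric

section Cube

variable {m : ℕ} {y : Fin (m + 1) → ℝ}

/-- In the sup norm balls are cubes, so an interval times a ball is again a ball; this makes
products with the interval into cells. -/
theorem norm_le_one_iff_tail : ‖y‖ ≤ 1 ↔ |y 0| ≤ 1 ∧ ‖Fin.tail y‖ ≤ 1 := by
  rw [pi_norm_le_iff_of_nonneg zero_le_one, pi_norm_le_iff_of_nonneg zero_le_one, Fin.forall_fin_succ]
  rfl

theorem norm_lt_one_iff_tail : ‖y‖ < 1 ↔ |y 0| < 1 ∧ ‖Fin.tail y‖ < 1 := by
  rw [pi_norm_lt_iff zero_lt_one, pi_norm_lt_iff zero_lt_one, Fin.forall_fin_succ]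
  rfl

theorem abs_eq_one_or_of_norm_eq_one (h : ‖y‖ = 1) : |y 0| = 1 ∨ ‖Fin.tail y‖ = 1 := by
  obtain ⟨h1, h2⟩ := norm_le_one_iff_tail.1 h.le
  by_contra! hc
  exact (norm_lt_one_iff_tail.2 ⟨h1.lt_of_ne hc.1, h2.lt_of_ne hc.2⟩).ne h

/-- The affine map from `[-1, 1]` to `[0, 1]`. -/
noncomputable def rescale (r : ℝ) : I := projIcc 0 1 zero_le_one ((r + 1) / 2)

theorem continuous_rescale : Continuous rescale :=
  continuous_projIcc.comp (by fun_prop)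

theorem coe_rescale {r : ℝ} (hr : |r| ≤ 1) : (rescale r : ℝ) = (r + 1) / 2 := by
  obtain ⟨h1, h2⟩ := abs_le.1 hr
  rw [rescale, projIcc_of_mem zero_le_one (show (r + 1) / 2 ∈ Icc (0 : ℝ) 1 from
    ⟨by linarith, by linarith⟩)]

theorem rescale_two_mul_sub_one (t : I) : rescale (2 * t - 1) = t := by
  rw [rescale, show ((2 * t - 1 + 1) / 2 : ℝ) = t by ring, projIcc_val]

theorem rescale_neg_one : rescale (-1) = 0 := by
  simp [rescale]

theorem rescale_one : rescale 1 = 1 := by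
  norm_num [rescale]

theorem rescale_lt_one {r : ℝ} (hr : |r| < 1) : rescale r < 1 := by
  rw [← Subtype.coe_lt_coe, coe_rescale hr.le]
  have := (abs_lt.1 hr).2
  change (r + 1) / 2 < 1
  linarith

theorem rescale_pos {r : ℝ} (hr : |r| < 1) : 0 < rescale r := by
  rw [← Subtype.coe_lt_coe, coe_rescale hr.le]
  have := (abs_lt.1 hr).1
  change 0 < (r + 1) / 2
  linarith

end Cube

/-- The partial equivalence from `s` to `a '' s` given by a map `a` with a left inverse `b`
on `s`. -/
@[simps]
def partialEquivOfLeftInvOn {α β : Type*} (a : α → β) (b : β → α) (s : Set α)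
    (h : ∀ x ∈ s, b (a x) = x) : PartialEquiv α β where
  toFun := a
  invFun := b
  source := s
  target := a '' s
  map_source' x hx := mem_image_of_mem a hx
  map_target' := by
    rintro _ ⟨x, hx, rfl⟩
    rwa [h x hx]
  left_inv' := h
  right_inv' := by
    rintro _ ⟨x, hx, rfl⟩
    rw [h x hx]

/-- The cells of a telescope: the cells of the bottoms `X × {0}` of the cylinders, and the products
of the cells of `X` with the open interval. -/
inductive TelescopeCell.{u} (X : Type u) [TopologicalSpace X] [CWComplex (univ : Set X)] :
    ℕ → Type u
  | bottom (k : ℤ) {m : ℕ} (e : RelCWComplex.cell (univ : Set X) m) : TelescopeCell X m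
  | side (k : ℤ) {m : ℕ} (e : RelCWComplex.cell (univ : Set X) m) : TelescopeCell X (m + 1)

namespace Telescope

variable {B X : Type*} [Group B] [TopologicalSpace X] [MulAction B X]
  [CWComplex (univ : Set X)] {φ : MulAut B}

/-- The characteristic maps of the cells of a telescope. -/
noncomputable def charMap (f : TwistedMap φ X) :
    ∀ m : ℕ, TelescopeCell X m → (Fin m → ℝ) → Telescope f
  | _, .bottom k e, y => mk f k (RelCWComplex.map _ e y) 0
  | _, .side k e, y => mk f k (RelCWComplex.map _ e (Fin.tail y)) (rescale (y 0))

/-- The inverses of the characteristic maps of the cells of a telescope. -/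
noncomputable def charInv (f : TwistedMap φ X) :
    ∀ m : ℕ, TelescopeCell X m → Telescope f → (Fin m → ℝ)
  | _, .bottom _ e, p => (RelCWComplex.map _ e).symm (base p)
  | _, .side _ e, p => Fin.cons (2 * time p - 1) ((RelCWComplex.map _ e).symm (base p))

variable {f : TwistedMap φ X}

theorem map_symm_map {m : ℕ} {e : RelCWComplex.cell (univ : Set X) m} {y : Fin m → ℝ}
    (hy : ‖y‖ < 1) : (RelCWComplex.map m e).symm (RelCWComplex.map m e y) = y :=
  (RelCWComplex.map m e).left_inv (by rw [RelCWComplex.source_eq]; simpa using hy)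

theorem target_map {m : ℕ} (e : RelCWComplex.cell (univ : Set X) m) :
    (RelCWComplex.map m e).target = RelCWComplex.openCell m e := by
  rw [← (RelCWComplex.map m e).image_source_eq_target, RelCWComplex.source_eq]
  rfl

theorem charInv_charMap (m : ℕ) (c : TelescopeCell X m) :
    ∀ y ∈ ball (0 : Fin m → ℝ) 1, charInv f m c (charMap f m c y) = y := by
  intro y hy
  rw [mem_ball_zero_iff] at hy
  cases c with
  | bottom k e =>
    simp only [charInv, charMap, (coord_mk k _ zero_lt_one).2.1]
    exact map_symm_map hy
  | side k e =>
    obtain ⟨h0, h1⟩ := norm_lt_one_iff_tail.1 hy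
    obtain ⟨-, hb, ht⟩ := coord_mk (f := f) k (RelCWComplex.map _ e (Fin.tail y))
      (rescale_lt_one h0)
    simp only [charInv, charMap, hb, ht, map_symm_map h1, coe_rescale h0.le]
    rw [show 2 * ((y 0 + 1) / 2) - 1 = y 0 by ring, Fin.cons_self_tail]

/-- Coordinates turn open cells into conditions on index, base and time, from which disjointness and
the effect of the group action are read off. -/
theorem image_bottom_ball (k : ℤ) {m : ℕ} (e : RelCWComplex.cell (univ : Set X) m) :
    charMap f m (.bottom k e) '' ball 0 1 =
      {p | index p = k ∧ base p ∈ RelCWComplex.openCell m e ∧ time p = 0} := by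
  ext p
  constructor
  · rintro ⟨y, hy, rfl⟩
    obtain ⟨h1, h2, h3⟩ := coord_mk (f := f) k (RelCWComplex.map _ e y) zero_lt_one
    refine ⟨h1, ?_, h3⟩
    change base (mk f k (RelCWComplex.map _ e y) 0) ∈ _
    rw [h2]
    exact mem_image_of_mem _ hy
  · rintro ⟨h1, ⟨y, hy, h2⟩, h3⟩
    refine ⟨y, hy, ?_⟩
    rw [← mk_coord p, h1, h3, ← h2]
    rfl

theorem image_side_ball (k : ℤ) {m : ℕ} (e : RelCWComplex.cell (univ : Set X) m) :
    charMap f (m + 1) (.side k e) '' ball 0 1 =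
      {p | index p = k ∧ base p ∈ RelCWComplex.openCell m e ∧ 0 < time p} := by
  ext p
  constructor
  · rintro ⟨y, hy, rfl⟩
    obtain ⟨h0, h1⟩ := norm_lt_one_iff_tail.1 (mem_ball_zero_iff.1 hy)
    obtain ⟨hi, hb, ht⟩ := coord_mk (f := f) k (RelCWComplex.map _ e (Fin.tail y))
      (rescale_lt_one h0)
    change index (mk f k (RelCWComplex.map _ e (Fin.tail y)) (rescale (y 0))) = k ∧
      base (mk f k (RelCWComplex.map _ e (Fin.tail y)) (rescale (y 0))) ∈ _ ∧
      0 < time (mk f k (RelCWComplex.map _ e (Fin.tail y)) (rescale (y 0)))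
    rw [hi, hb, ht]
    exact ⟨rfl, mem_image_of_mem _ (mem_ball_zero_iff.2 h1), rescale_pos h0⟩
  · rintro ⟨h1, ⟨y, hy, h2⟩, h3⟩
    refine ⟨Fin.cons (2 * time p - 1) y, ?_, ?_⟩
    · rw [mem_ball_zero_iff, norm_lt_one_iff_tail, Fin.tail_cons, Fin.cons_zero, abs_lt]
      have h4 : (0 : ℝ) < time p := h3
      have h5 : (time p : ℝ) < 1 := time_lt_one p
      exact ⟨⟨by linarith, by linarith⟩, mem_ball_zero_iff.1 hy⟩
    · simp only [charMap, Fin.tail_cons, Fin.cons_zero, rescale_two_mul_sub_one]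
      rw [h2, ← h1, mk_coord]

theorem image_bottom_closedBall (k : ℤ) {m : ℕ} (e : RelCWComplex.cell (univ : Set X) m) :
    charMap f m (.bottom k e) '' closedBall 0 1 =
      (fun x => mk f k x 0) '' RelCWComplex.closedCell m e := by
  rw [RelCWComplex.closedCell, image_image]
  rfl

theorem image_side_closedBall (k : ℤ) {m : ℕ} (e : RelCWComplex.cell (univ : Set X) m) :
    charMap f (m + 1) (.side k e) '' closedBall 0 1 =
      (fun p : X × I => mk f k p.1 p.2) '' (RelCWComplex.closedCell m e ×ˢ univ) := by
  ext p
  constructor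
  · rintro ⟨y, hy, rfl⟩
    obtain ⟨h0, h1⟩ := norm_le_one_iff_tail.1 (mem_closedBall_zero_iff.1 hy)
    exact ⟨(RelCWComplex.map _ e (Fin.tail y), rescale (y 0)),
      ⟨mem_image_of_mem _ (mem_closedBall_zero_iff.2 h1), trivial⟩, rfl⟩
  · rintro ⟨⟨x, t⟩, ⟨⟨y, hy, rfl⟩, -⟩, rfl⟩
    refine ⟨Fin.cons (2 * t - 1) y, ?_, ?_⟩
    · rw [mem_closedBall_zero_iff, norm_le_one_iff_tail, Fin.tail_cons, Fin.cons_zero, abs_le]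
      exact ⟨⟨by linarith [t.2.1], by linarith [t.2.2]⟩, mem_closedBall_zero_iff.1 hy⟩
    · simp only [charMap, Fin.tail_cons, Fin.cons_zero, rescale_two_mul_sub_one]

theorem continuousOn_charMap (m : ℕ) (c : TelescopeCell X m) :
    ContinuousOn (charMap f m c) (closedBall 0 1) := by
  cases c with
  | bottom k e =>
    exact (continuous_mk k).comp_continuousOn
      ((RelCWComplex.continuousOn m e).prodMk continuousOn_const)
  | side k e =>
    refine (continuous_mk k).comp_continuousOn (ContinuousOn.prodMk ?_ ?_)
    · refine (RelCWComplex.continuousOn _ e).comp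
        (by unfold Fin.tail; fun_prop : Continuous fun y => Fin.tail y).continuousOn ?_
      intro y hy
      exact mem_closedBall_zero_iff.2 (norm_le_one_iff_tail.1 (mem_closedBall_zero_iff.1 hy)).2
    · exact (continuous_rescale.comp (continuous_apply 0)).continuousOn

theorem continuousOn_charInv (m : ℕ) (c : TelescopeCell X m) :
    ContinuousOn (charInv f m c) (charMap f m c '' ball 0 1) := by
  have key : ∀ (k : ℤ) {m : ℕ} (e : RelCWComplex.cell (univ : Set X) m),
      ContinuousOn (fun p : Telescope f => (RelCWComplex.map m e).symm (base p))
        {p | index p = k ∧ base p ∈ RelCWComplex.openCell m e} := by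
    intro k m e
    have h := RelCWComplex.continuousOn_symm m e
    rw [target_map] at h
    exact h.comp ((continuousOn_base k).mono fun p hp => hp.1) fun p hp => hp.2
  cases c with
  | bottom k e =>
    rw [image_bottom_ball]
    exact (key k e).mono fun p hp => ⟨hp.1, hp.2.1⟩
  | @side k m e =>
    rw [image_side_ball]
    have h1 := (key k e).mono (t := {p | index p = k ∧ base p ∈ RelCWComplex.openCell m e ∧
      0 < time p}) fun p hp => ⟨hp.1, hp.2.1⟩
    have h2 := (continuousOn_time (f := f) k).mono (t := {p | index p = k ∧
      base p ∈ RelCWComplex.openCell m e ∧ 0 < time p}) fun p hp => hp.1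
    refine continuousOn_pi.2 fun i => ?_
    refine Fin.cases ?_ (fun i => ?_) i
    · simp only [charInv, Fin.cons_zero]
      exact (continuousOn_const.mul (continuous_subtype_val.comp_continuousOn h2)).sub
        continuousOn_const
    · simp only [charInv, Fin.cons_succ]
      exact continuousOn_pi.1 h1 i

theorem pairwiseDisjoint_image_ball :
    (univ : Set (Σ m, TelescopeCell X m)).PairwiseDisjoint
      fun c => charMap f c.1 c.2 '' ball 0 1 := by
  rintro ⟨m, c⟩ - ⟨m', c'⟩ - hne
  rw [Function.onFun, disjoint_left]
  rintro p hp hp'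
  refine hne ?_
  have hcell : ∀ {m m' : ℕ} {e : RelCWComplex.cell (univ : Set X) m}
      {e' : RelCWComplex.cell (univ : Set X) m'}, base p ∈ RelCWComplex.openCell m e →
      base p ∈ RelCWComplex.openCell m' e' →
      (⟨m, e⟩ : Σ m, RelCWComplex.cell (univ : Set X) m) = ⟨m', e'⟩ := fun h h' =>
    RelCWComplex.eq_of_not_disjoint_openCell (not_disjoint_iff.2 ⟨_, h, h'⟩)
  cases c with
  | bottom k e =>
    rw [image_bottom_ball] at hp
    cases c' with
    | bottom k' e' =>
      rw [image_bottom_ball] at hp'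
      obtain rfl : k = k' := hp.1.symm.trans hp'.1
      cases hcell hp.2.1 hp'.2.1
      rfl
    | side k' e' =>
      rw [image_side_ball] at hp'
      exact absurd hp.2.2 hp'.2.2.ne'
  | side k e =>
    rw [image_side_ball] at hp
    cases c' with
    | bottom k' e' =>
      rw [image_bottom_ball] at hp'
      exact absurd hp'.2.2 hp.2.2.ne'
    | side k' e' =>
      rw [image_side_ball] at hp'
      obtain rfl : k = k' := hp.1.symm.trans hp'.1
      cases hcell hp.2.1 hp'.2.1
      rfl

variable [T2Space X]

theorem isClosed_of_isClosed_inter {A : Set (Telescope f)}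
    (h : ∀ m (c : TelescopeCell X m), IsClosed (A ∩ charMap f m c '' closedBall 0 1)) :
    IsClosed A := by
  refine isClosed_iff.2 fun k => isClosed_prod_unitInterval fun n e => ?_
  have h1 := (h (n + 1) (.side k e)).preimage (continuous_mk k)
  rw [image_side_closedBall] at h1
  -- At the top, `f` may identify points of the cell with points outside it, so the condition on the
  -- first coordinate has to be added.
  convert h1.inter (RelCWComplex.isClosed_closedCell (n := n) (i := e)|>.preimage
    (continuous_fst : Continuous (Prod.fst : X × I → X))) using 1
  ext ⟨x, t⟩
  constructor
  · rintro ⟨hA, hx, -⟩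
    exact ⟨⟨hA, (x, t), ⟨hx, trivial⟩, rfl⟩, hx⟩
  · rintro ⟨⟨hA, -⟩, hx⟩
    exact ⟨hA, hx, trivial⟩

/-- The boundary of a cell of the telescope of a cellular map meets only finitely many closed cells
of lower dimension. -/
theorem exists_finset_mapsTo_sphere (hf : IsCellular f.toFun) (m : ℕ) (c : TelescopeCell X m) :
    ∃ s : ∀ l, Finset (TelescopeCell X l), MapsTo (charMap f m c) (sphere 0 1)
      (⋃ (l < m) (j ∈ s l), charMap f l j '' closedBall 0 1) := by
  suffices h : ∃ s : Set (Σ l, TelescopeCell X l), s.Finite ∧ ∀ y ∈ sphere (0 : Fin m → ℝ) 1,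
      ∃ j ∈ s, j.1 < m ∧ charMap f m c y ∈ charMap f j.1 j.2 '' closedBall 0 1 by
    obtain ⟨s, hs, h⟩ := h
    refine ⟨fun l => (hs.preimage (f := fun j => (⟨l, j⟩ : Σ l, TelescopeCell X l))
      sigma_mk_injective.injOn).toFinset, fun y hy => ?_⟩
    obtain ⟨⟨l, j⟩, hj, hl, hjy⟩ := h y hy
    simp only [mem_iUnion, exists_prop]
    exact ⟨l, hl, j, by simpa using hj, hjy⟩
  have hfr : ∀ {m : ℕ} (e : RelCWComplex.cell (univ : Set X) m),
      ∃ s : Set (Σ l, RelCWComplex.cell (univ : Set X) l), s.Finite ∧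
        ∀ x ∈ RelCWComplex.cellFrontier m e, ∃ j ∈ s, j.1 < m ∧
          x ∈ RelCWComplex.closedCell j.1 j.2 := by
    intro m e
    obtain ⟨s, hs⟩ := CWComplex.cellFrontier_subset_finite_closedCell m e
    refine ⟨⋃ l ∈ Finset.range m, Sigma.mk l '' (s l : Set _),
      Set.Finite.biUnion (Finset.finite_toSet _) fun l _ => (Finset.finite_toSet _).image _,
      fun x hx => ?_⟩
    have := hs hx
    simp only [mem_iUnion, exists_prop] at this
    obtain ⟨l, hl, j, hj, hjx⟩ := this
    refine ⟨⟨l, j⟩, ?_, hl, hjx⟩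
    simp only [mem_iUnion, exists_prop]
    exact ⟨l, by simpa using hl, j, hj, rfl⟩
  let bot : ℤ → (Σ l, RelCWComplex.cell (univ : Set X) l) → Σ l, TelescopeCell X l :=
    fun k j => ⟨j.1, .bottom k j.2⟩
  let sid : ℤ → (Σ l, RelCWComplex.cell (univ : Set X) l) → Σ l, TelescopeCell X l :=
    fun k j => ⟨j.1 + 1, .side k j.2⟩
  cases c with
  | bottom k e =>
    obtain ⟨s, hs, hse⟩ := hfr e
    refine ⟨bot k '' s, hs.image _, fun y hy => ?_⟩
    obtain ⟨j, hj, hjm, hjx⟩ := hse _ (mem_image_of_mem _ hy)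
    refine ⟨bot k j, mem_image_of_mem _ hj, hjm, ?_⟩
    rw [image_bottom_closedBall]
    exact mem_image_of_mem _ hjx
  | @side k m e =>
    obtain ⟨s, hs, hse⟩ := hfr e
    -- The boundary of a side cell has a bottom, a wall over the frontier of `e`, and a top glued by
    -- `f` into the next cylinder. The top meets finitely many open cells by compactness, and those
    -- have dimension at most `m` by cellularity.
    have hcpt : IsCompact (f.toFun '' RelCWComplex.closedCell m e) :=
      RelCWComplex.isCompact_closedCell.image f.continuous_toFun
    have hfin := finite_openCell_inter_of_isCompact (C := (univ : Set X)) hcpt (subset_univ _)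
    refine ⟨sid k '' s ∪ bot (k + 1) '' _ ∪ {bot k ⟨m, e⟩},
      ((hs.image _).union (hfin.image _)).union (finite_singleton _), fun y hy => ?_⟩
    rw [mem_sphere_zero_iff_norm] at hy
    have hmem : RelCWComplex.map m e (Fin.tail y) ∈ RelCWComplex.closedCell m e :=
      mem_image_of_mem _ (mem_closedBall_zero_iff.2 (norm_le_one_iff_tail.1 hy.le).2)
    rcases abs_eq_one_or_of_norm_eq_one hy with h | h
    · rcases (abs_eq zero_le_one).1 h with h | h
      · obtain ⟨l, hl, j, hj⟩ := CWComplex.mem_skeletonLT_iff.1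
          (hf m (RelCWComplex.closedCell_subset_skeleton m e hmem))
        refine ⟨bot (k + 1) ⟨l, j⟩, Or.inl (Or.inr (mem_image_of_mem _ ?_)),
          by exact_mod_cast hl, ?_⟩
        · exact ⟨_, hj, mem_image_of_mem _ hmem⟩
        · rw [image_bottom_closedBall]
          refine ⟨_, RelCWComplex.openCell_subset_closedCell l j hj, ?_⟩
          simp only [charMap, h, rescale_one, glue]
      · refine ⟨bot k ⟨m, e⟩, Or.inr rfl, Nat.lt_succ_self m, ?_⟩
        rw [image_bottom_closedBall]
        refine ⟨_, hmem, ?_⟩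
        simp only [charMap, h, rescale_neg_one]
    · obtain ⟨j, hj, hjm, hjx⟩ := hse (RelCWComplex.map m e (Fin.tail y))
        (mem_image_of_mem _ (mem_sphere_zero_iff_norm.2 h))
      refine ⟨sid k j, Or.inl (Or.inl (mem_image_of_mem _ hj)), Nat.succ_lt_succ hjm, ?_⟩
      rw [image_side_closedBall]
      exact ⟨(_, rescale (y 0)), ⟨hjx, trivial⟩, rfl⟩

/-- The CW-structure on the telescope of a cellular map. -/
@[reducible]
noncomputable def cwComplex (hf : IsCellular f.toFun) : CWComplex (univ : Set (Telescope f)) where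
  cell := TelescopeCell X
  map m c := partialEquivOfLeftInvOn (charMap f m c) (charInv f m c) (ball 0 1)
    (charInv_charMap m c)
  source_eq m c := rfl
  continuousOn := continuousOn_charMap
  continuousOn_symm := continuousOn_charInv
  pairwiseDisjoint' := pairwiseDisjoint_image_ball
  mapsTo' := exists_finset_mapsTo_sphere hf
  closed' A _ h := isClosed_of_isClosed_inter h
  union' := by
    refine eq_univ_of_forall fun p => ?_
    obtain ⟨m, e, he⟩ := exists_mem_openCell (base p)
    refine mem_iUnion₂.2 ⟨m + 1, .side (index p) e, ?_⟩
    change p ∈ charMap f (m + 1) (.side (index p) e) '' closedBall 0 1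
    rw [image_side_closedBall]
    exact ⟨(base p, time p), ⟨RelCWComplex.openCell_subset_closedCell m e he, trivial⟩,
      mk_coord p⟩

end Telescope

/-! ### The extended family of subgroups -/

theorem isFamily_extendFamily {B : Type*} [Group B] {φ : MulAut B} {F : Set (Subgroup B)}
    (hF : IsFamily F) (hφ : IsInvariant φ F) : IsFamily (extendFamily φ F) where
  nonempty := hF.nonempty.image _
  conj_mem := by
    rintro g _ ⟨K, hK, rfl⟩
    -- On `B`, conjugation by `(b, r)` is `φ^r` followed by conjugation by `b`.
    refine ⟨(K.map (φ ^ g.right.toAdd : MulAut B).toMonoidHom).map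
      (MulAut.conj g.left).toMonoidHom, hF.conj_mem _ _ (hφ _ _ hK), ?_⟩
    simp only [Subgroup.map_map]
    congr 1
    ext b
    · simp [SemidirectProduct.mul_left, SemidirectProduct.inv_left, zpowersHom_apply]
    · simp
  mem_of_le := by
    rintro _ ⟨K, hK, rfl⟩ L hL
    refine ⟨L.comap SemidirectProduct.inl, hF.mem_of_le K hK _ ?_, ?_⟩
    · refine (Subgroup.comap_mono hL).trans ?_
      rw [Subgroup.comap_map_eq_self_of_injective SemidirectProduct.inl_injective]
    · refine Subgroup.map_comap_eq_self (hL.trans ?_)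
      rw [MonoidHom.range_eq_map]
      exact Subgroup.map_mono le_top

/-! ### The action on the telescope and its fixed points -/

namespace Telescope

variable {B X : Type*} [Group B] [TopologicalSpace X] [MulAction B X] {φ : MulAut B}
  {f : TwistedMap φ X}

theorem smul_mk (g : CyclicExtension φ) (k : ℤ) (x : X) (t : I) :
    g • mk f k x t = mk f (k + g.right.toAdd)
      ((φ ^ (-(k + g.right.toAdd)) : MulAut B) g.left • x) t := rfl

theorem inl_smul_mk (b : B) (k : ℤ) (x : X) (t : I) :
    (SemidirectProduct.inl b : CyclicExtension φ) • mk f k x t =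
      mk f k ((φ ^ (-k) : MulAut B) b • x) t := by
  rw [smul_mk]
  simp

theorem continuous_smul (hX : ∀ b : B, Continuous fun x : X => b • x) (g : CyclicExtension φ) :
    Continuous fun p : Telescope f => g • p :=
  continuous_iff.2 fun k => by
    simp only [smul_mk]
    exact (continuous_mk _).comp (((hX _).comp continuous_fst).prodMk continuous_snd)

theorem height_smul (g : CyclicExtension φ) (p : Telescope f) :
    height f (g • p) = height f p + g.right.toAdd := by
  obtain ⟨k, x, t, -, rfl⟩ := exists_rep p
  rw [smul_mk, height_mk, height_mk]
  push_cast
  ring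

/-- The action in terms of coordinates. -/
theorem coord_smul (g : CyclicExtension φ) (p : Telescope f) :
    index (g • p) = index p + g.right.toAdd ∧
      base (g • p) = (φ ^ (-(index p + g.right.toAdd)) : MulAut B) g.left • base p ∧
      time (g • p) = time p := by
  have h := coord_mk (f := f) (index p + g.right.toAdd)
    ((φ ^ (-(index p + g.right.toAdd)) : MulAut B) g.left • base p) (time_lt_one p)
  rwa [← smul_mk, mk_coord] at h

section FixedPoints

/-- The part of the `k`-th cylinder fixed by a subgroup of `B`. -/
def fixedBase (φ : MulAut B) (X : Type*) [MulAction B X] (K : Subgroup B) (k : ℤ) : Set X :=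
  MulAction.fixedPoints (K.map (φ ^ (-k) : MulAut B).toMonoidHom) X

omit [TopologicalSpace X] in
theorem mem_fixedBase {K : Subgroup B} {k : ℤ} {x : X} :
    x ∈ fixedBase φ X K k ↔ ∀ b ∈ K, (φ ^ (-k) : MulAut B) b • x = x := by
  constructor
  · intro h b hb
    exact h ⟨_, b, hb, rfl⟩
  · rintro h ⟨_, b, hb, rfl⟩
    exact h b hb

theorem mapsTo_fixedBase (f : TwistedMap φ X) (K : Subgroup B) (k : ℤ) :
    MapsTo f.toFun (fixedBase φ X K k) (fixedBase φ X K (k + 1)) := by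
  intro x hx
  rw [mem_fixedBase] at hx ⊢
  intro b hb
  rw [show -(k + 1) = -1 + -k by ring, zpow_add, MulAut.mul_apply, zpow_neg_one, ← f.map_smul,
    hx b hb]

/-- Below the top the coordinates are unique, so fixing the class means fixing `x`. At `t = 1` only
`f x` would have to be fixed. -/
theorem mk_mem_fixedPoints_iff {K : Subgroup B} {k : ℤ} {x : X} {t : I} (ht : t < 1) :
    mk f k x t ∈ MulAction.fixedPoints
      (K.map (SemidirectProduct.inl : B →* CyclicExtension φ)) (Telescope f) ↔
      x ∈ fixedBase φ X K k := by
  rw [mem_fixedBase]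
  constructor
  · intro h b hb
    have := h ⟨_, b, hb, rfl⟩
    rw [Subgroup.smul_def, inl_smul_mk] at this
    exact (mk_injective ht ht this).2.1
  · rintro h ⟨_, b, hb, rfl⟩
    rw [Subgroup.smul_def, inl_smul_mk, h b hb]

/-- The restriction of a twisted map to the fixed points of a subgroup of `B`. -/
def restrictFixed (f : TwistedMap φ X) (K : Subgroup B) (k : ℤ) :
    fixedBase φ X K k → fixedBase φ X K (k + 1) := (mapsTo_fixedBase f K k).restrict

/-- The inclusion of the telescope of the fixed point sets. -/
def fixedInclusion (f : TwistedMap φ X) (K : Subgroup B) :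
    FamilyTelescope (restrictFixed f K) → Telescope f :=
  Quot.lift (fun p => mk f p.1 p.2.1 p.2.2) (by
    rintro _ _ ⟨k, x⟩
    exact glue (f := f) k x.1)

theorem fixedInclusion_mk (K : Subgroup B) (k : ℤ) (x : fixedBase φ X K k) (t : I) :
    fixedInclusion f K (FamilyTelescope.mk _ k (x, t)) = mk f k x t := rfl

theorem exists_family_rep {S : ℤ → Type*} {f : ∀ k, S k → S (k + 1)} (p : FamilyTelescope f) :
    ∃ k x t, t < 1 ∧ p = FamilyTelescope.mk f k (x, t) := by
  obtain ⟨k, x, t, rfl⟩ := FamilyTelescope.exists_eq_mk p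
  rcases lt_or_eq_of_le (show t ≤ 1 from t.2.2) with ht | rfl
  · exact ⟨k, x, t, ht, rfl⟩
  · exact ⟨k + 1, f k x, 0, zero_lt_one, FamilyTelescope.glue k x⟩

theorem continuous_fixedInclusion (K : Subgroup B) : Continuous (fixedInclusion f K) :=
  continuous_quot_lift _ (continuous_sigma fun k => (continuous_mk (f := f) k).comp
    (by fun_prop : Continuous fun p : fixedBase φ X K k × I => ((p.1 : X), p.2)))

theorem fixedInclusion_injective (K : Subgroup B) : Function.Injective (fixedInclusion f K) := by
  intro p q h
  obtain ⟨k, x, t, ht, rfl⟩ := exists_family_rep p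
  obtain ⟨k', x', t', ht', rfl⟩ := exists_family_rep q
  simp only [fixedInclusion_mk] at h
  obtain ⟨rfl, hx, rfl⟩ := mk_injective ht ht' h
  rw [Subtype.ext hx]

theorem range_fixedInclusion (K : Subgroup B) :
    range (fixedInclusion f K) = MulAction.fixedPoints
      (K.map (SemidirectProduct.inl : B →* CyclicExtension φ)) (Telescope f) := by
  ext p
  constructor
  · rintro ⟨p, rfl⟩
    obtain ⟨k, x, t, ht, rfl⟩ := exists_family_rep p
    exact (mk_mem_fixedPoints_iff ht).2 x.2
  · intro h
    obtain ⟨k, x, t, ht, rfl⟩ := exists_rep p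
    exact ⟨FamilyTelescope.mk _ k (⟨x, (mk_mem_fixedPoints_iff ht).1 h⟩, t), rfl⟩

theorem isClosedMap_fixedInclusion {K : Subgroup B} (hK : ∀ k, IsClosed (fixedBase φ X K k)) :
    IsClosedMap (fixedInclusion f K) := by
  intro C hC
  rw [isClosed_iff]
  intro k
  have h1 : IsClosed ((fun p : fixedBase φ X K k × I => ((p.1 : X), p.2)) ''
      (FamilyTelescope.mk (restrictFixed f K) k ⁻¹' C)) :=
    ((hK k).isClosedEmbedding_subtypeVal.prodMap .id).isClosedMap _
      (hC.preimage (FamilyTelescope.continuous_mk k))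
  have h2 : IsClosed (Subtype.val '' {x : fixedBase φ X K (k + 1) |
      FamilyTelescope.mk (restrictFixed f K) (k + 1) (x, 0) ∈ C}) :=
    (hK (k + 1)).isClosedEmbedding_subtypeVal.isClosedMap _
      (hC.preimage ((FamilyTelescope.continuous_mk (k + 1)).comp (by fun_prop)))
  -- The preimage in the `k`-th cylinder also contains points `(x, 1)` with `f x` fixed, even when
  -- `x` itself is not.
  have h3 := (h2.preimage (f.continuous_toFun.comp (continuous_fst (X := X) (Y := I)))).inter
    (isClosed_singleton (x := (1 : I)).preimage (continuous_snd (X := X) (Y := I)))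
  convert h1.union h3 using 1
  ext ⟨x, t⟩
  constructor
  · rintro ⟨c, hc, h⟩
    obtain ⟨j, z, s, hs, rfl⟩ := exists_family_rep c
    rw [fixedInclusion_mk] at h
    rcases lt_or_eq_of_le (show t ≤ 1 from t.2.2) with ht | rfl
    · obtain ⟨rfl, hz, rfl⟩ := mk_injective hs ht h
      exact Or.inl ⟨(z, s), hc, Prod.ext hz rfl⟩
    · simp only [glue] at h
      obtain ⟨rfl, hz, rfl⟩ := mk_injective hs zero_lt_one h
      exact Or.inr ⟨⟨z, hc, hz⟩, rfl⟩
  · rintro (⟨⟨z, s⟩, hc, h⟩ | ⟨⟨z, hc, h⟩, ht⟩)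
    · obtain ⟨rfl, rfl⟩ := Prod.ext_iff.1 h
      exact ⟨_, hc, rfl⟩
    · refine ⟨_, hc, ?_⟩
      rw [fixedInclusion_mk, h, show t = 1 from ht]
      exact (glue k x).symm

/-- The fixed points of a subgroup of `B` form a contractible subspace of the telescope if those of
its translates do in the base. -/
theorem contractibleSpace_fixedPoints {K : Subgroup B}
    (hK : ∀ k, IsClosed (fixedBase φ X K k)) (hc : ∀ k, ContractibleSpace (fixedBase φ X K k)) :
    ContractibleSpace (MulAction.fixedPoints
      (K.map (SemidirectProduct.inl : B →* CyclicExtension φ)) (Telescope f)) := by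
  have he : IsClosedEmbedding (fixedInclusion f K) :=
    .of_continuous_injective_isClosedMap (continuous_fixedInclusion K)
      (fixedInclusion_injective K) (isClosedMap_fixedInclusion hK)
  have := contractibleSpace_familyTelescope (f := restrictFixed f K)
    (fun k => f.continuous_toFun.restrict (mapsTo_fixedBase f K k))
  rw [← range_fixedInclusion]
  exact he.isEmbedding.toHomeomorph.symm.contractibleSpace

end FixedPoints

/-! ### The telescope as a model -/

section Model

variable [T2Space X] [CWComplex (univ : Set X)]

/-- The action of `(b, r)` preserves the time and adds `r` to the index. If it returns a point to
its cell, then `r = 0` and it acts on the base through an element of `B`, so the property of `X`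
applies. -/
theorem isGCWComplex (hX : IsGCWComplex B X) (hf : IsCellular f.toFun) :
    letI := cwComplex hf
    IsGCWComplex (CyclicExtension φ) (Telescope f) := by
  let := cwComplex hf
  have hopen : ∀ (m : ℕ) (c : TelescopeCell X m),
      RelCWComplex.openCell (C := (univ : Set (Telescope f))) m c =
        charMap f m c '' Metric.ball 0 1 := fun _ _ => rfl
  have hact : ∀ (g : CyclicExtension φ) (k : ℤ) {m : ℕ}
      (e : RelCWComplex.cell (univ : Set X) m), ∃ e' : RelCWComplex.cell (univ : Set X) m,
      ∀ p : Telescope f, (index p = k ∧ base p ∈ RelCWComplex.openCell m e) ↔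
        (index (g • p) = k + g.right.toAdd ∧ base (g • p) ∈ RelCWComplex.openCell m e') := by
    intro g k m e
    obtain ⟨e', he'⟩ := hX.smul_openCell ((φ ^ (-(k + g.right.toAdd)) : MulAut B) g.left) m e
    refine ⟨e', fun p => ?_⟩
    obtain ⟨h1, h2, -⟩ := coord_smul g p
    rw [h1, h2, add_left_inj]
    refine and_congr_right fun hk => ?_
    rw [hk, ← he', smul_mem_smul_set_iff]
  have himage : ∀ (g : CyclicExtension φ) (S T : Set (Telescope f)),
      (∀ p, p ∈ S ↔ g • p ∈ T) → g • S = T := by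
    intro g S T h
    ext p
    rw [mem_smul_set_iff_inv_smul_mem, h, smul_inv_smul]
  have hfix : ∀ (g : CyclicExtension φ) (k : ℤ) {m : ℕ}
      (e : RelCWComplex.cell (univ : Set X) m) (p : Telescope f),
      index p = k → base p ∈ RelCWComplex.openCell m e →
      index (g • p) = k → base (g • p) ∈ RelCWComplex.openCell m e →
      ∀ q : Telescope f, index q = k → base q ∈ RelCWComplex.openCell m e → g • q = q := by
    intro g k m e p hp hpe hgp hgpe q hq hqe
    obtain ⟨h1, h2, -⟩ := coord_smul g p
    obtain ⟨h3, h4, h5⟩ := coord_smul g q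
    have hr : g.right.toAdd = 0 := by
      rw [h1, hp] at hgp
      exact left_eq_add.1 hgp.symm
    rw [h2] at hgpe
    rw [hq] at h3 h4
    rw [hp] at hgpe
    rw [hX.smul_eq_self _ m e _ hpe hgpe _ hqe] at h4
    rw [← mk_coord (g • q), h3, h4, h5, hr, add_zero, ← hq, mk_coord]
  refine ⟨inferInstance, continuous_smul hX.continuous_smul, fun g m c => ?_,
    fun g m c p hp hgp q hq => ?_⟩
  · change TelescopeCell X m at c
    cases c with
    | bottom k e =>
      obtain ⟨e', he'⟩ := hact g k e
      refine ⟨TelescopeCell.bottom (k + g.right.toAdd) e', himage g _ _ fun p => ?_⟩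
      rw [hopen, hopen, image_bottom_ball, image_bottom_ball, mem_ofPred_eq, mem_ofPred_eq,
        (coord_smul g p).2.2, ← and_assoc, ← and_assoc, he' p]
    | side k e =>
      obtain ⟨e', he'⟩ := hact g k e
      refine ⟨TelescopeCell.side (k + g.right.toAdd) e', himage g _ _ fun p => ?_⟩
      rw [hopen, hopen, image_side_ball, image_side_ball, mem_ofPred_eq, mem_ofPred_eq,
        (coord_smul g p).2.2, ← and_assoc, ← and_assoc, he' p]
  · change TelescopeCell X m at c
    rw [hopen] at hp hgp hq
    cases c with
    | bottom k e =>
      rw [image_bottom_ball] at hp hgp hq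
      exact hfix g k e p hp.1 hp.2.1 hgp.1 hgp.2.1 q hq.1 hq.2.1
    | side k e =>
      rw [image_side_ball] at hp hgp hq
      exact hfix g k e p hp.1 hp.2.1 hgp.1 hgp.2.1 q hq.1 hq.2.1

theorem hasDimension {n : ℕ} (hX : HasDimension X n) (hf : IsCellular f.toFun) :
    letI := cwComplex hf
    HasDimension (Telescope f) (n + 1) := by
  let := cwComplex hf
  constructor
  · obtain ⟨e⟩ := hX.nonempty_cell
    exact ⟨TelescopeCell.side 0 e⟩
  · intro m hm
    refine ⟨fun c => ?_⟩
    change TelescopeCell X m at c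
    cases c with
    | bottom k e => exact (hX.isEmpty_cell m (by omega)).false e
    | side k e => exact (hX.isEmpty_cell _ (by omega)).false e

theorem isModel {F : Set (Subgroup B)} (hφ : IsInvariant φ F) {n : ℕ} (hX : IsModel B F X n)
    (hf : IsCellular f.toFun) :
    letI := cwComplex hf
    IsModel (CyclicExtension φ) (extendFamily φ F) (Telescope f) (n + 1) := by
  let := cwComplex hf
  refine ⟨isGCWComplex hX.isGCWComplex hf, hasDimension hX.hasDimension hf, ?_, fun H hH => ?_⟩
  · rintro _ ⟨K, hK, rfl⟩
    exact contractibleSpace_fixedPoints (fun k => hX.isGCWComplex.isClosed_fixedPoints _)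
      fun k => hX.contractible _ (hφ (-k) K hK)
  · by_contra hne
    obtain ⟨p, hp⟩ := nonempty_iff_ne_empty.2 hne
    -- A nontrivial translation of the height has no fixed point.
    have hright : ∀ g ∈ H, g.right = 1 := by
      intro g hg
      have h1 : g • p = p := hp ⟨g, hg⟩
      have h2 := height_smul g p
      rw [h1] at h2
      have h3 : (g.right.toAdd : ℝ) = 0 := left_eq_add.1 h2
      exact toAdd_eq_zero.1 (by exact_mod_cast h3)
    have hHrange : H ≤ (SemidirectProduct.inl : B →* CyclicExtension φ).range := by
      intro g hg
      refine ⟨g.left, SemidirectProduct.ext rfl ?_⟩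
      rw [hright g hg]
      rfl
    set K : Subgroup B := H.comap (SemidirectProduct.inl : B →* CyclicExtension φ) with hKdef
    have hKH : K.map SemidirectProduct.inl = H := Subgroup.map_comap_eq_self hHrange
    obtain ⟨k, x, t, ht, rfl⟩ := exists_rep p
    rw [← hKH, mk_mem_fixedPoints_iff ht] at hp
    have hKF : K.map (φ ^ (-k) : MulAut B).toMonoidHom ∈ F := by
      by_contra h
      have := hX.fixedPoints_eq_empty _ h
      change x ∈ MulAction.fixedPoints _ X at hp
      rw [this] at hp
      exact hp
    -- Membership of `φ^(-k)(K)` in `F` is carried back to `K` by applying `φ^k`.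
    refine hH ⟨K, ?_, hKH⟩
    have h := hφ k _ hKF
    rw [Subgroup.map_map] at h
    convert h
    conv_lhs => rw [← Subgroup.map_id K]
    congr 1
    ext b
    change b = (φ ^ k : MulAut B) ((φ ^ (-k) : MulAut B) b)
    rw [← MulAut.mul_apply, ← zpow_add, add_neg_cancel, zpow_zero, MulAut.one_apply]

end Model

end Telescope

end ClassifyingSpace

theorem mainTheorem3 {B : Type*} [Group B] (φ : MulAut B) (F : Set (Subgroup B))
    (hF : ClassifyingSpace.IsFamily F) (hφ : ClassifyingSpace.IsInvariant φ F)
    {X : Type*} [TopologicalSpace X] [T2Space X] [MulAction B X]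
    [CWComplex (univ : Set X)] (n : ℕ)
    (hX : ClassifyingSpace.IsModel B F X n) :
    ClassifyingSpace.IsFamily (ClassifyingSpace.extendFamily φ F) ∧
      (∃ f : ClassifyingSpace.TwistedMap φ X, ClassifyingSpace.IsCellular f.toFun) ∧
      ∀ f : ClassifyingSpace.TwistedMap φ X, ClassifyingSpace.IsCellular f.toFun →
        ∃ _ : CWComplex (univ : Set (ClassifyingSpace.Telescope f)),
          ClassifyingSpace.IsModel (ClassifyingSpace.CyclicExtension φ)
            (ClassifyingSpace.extendFamily φ F) (ClassifyingSpace.Telescope f) (n + 1) :=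
  ⟨ClassifyingSpace.isFamily_extendFamily hF hφ,
    ClassifyingSpace.exists_isCellular_twistedMap hφ hX,
    fun _ hf => ⟨ClassifyingSpace.Telescope.cwComplex hf,
      ClassifyingSpace.Telescope.isModel hφ hX hf⟩⟩
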